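/- **Theorem 3 (Joint convergence to multi time Brownian fields).** *Setting.* A point $(x,v,r)\in\mathbb R^3$ represents the space-time line $\ell(x,v)=\{(x+vt,t):t\in\mathbb R\}$ with mark $r$. A space-time point $(x',t')$ is to the right of the line if $x'\ge x+vt'$ and to its left otherwise. For $a,b\in\mathbb R^2$ let $ab$ be the set of $(x,v,r)$ such that $\ell(x,v)$ meets the segment $\overline{ab}$, let $ab_+$ be the set of those having $a$ on the left and $b$ on the right, and $ab_-$ the set of those having $a$ on the right and $b$ on the left. For a measure $\nu$ on $\mathbb R^3$ put $d\nu_2(x,v,r)=r^2\,d\nu(x,v,r)$ and, with $o$ the origin, $H_\nu(b)=\int r\,(\mathbf 1_{ob_+}-\mathbf 1_{ob_-})\,d\nu$. Let $d\mu(x,v,r)=\rho(x)\,dx\,d\mu(v,r|x)$, where $\rho\ge 0$ is locally integrable and $\mu(\cdot|x)$ are probability measures on $\mathbb R^2$, depending measurably on $x$, and assume that $\mu(ab)+\mu_2(ab)<\infty$ for all $a,b$. Assume that at every time $s'$ the image of $\mu$ under $(x,v,r)\mapsto(x+vs',v,r)$ has again a disintegration $dx\,\lambda_{x,s'}(dv,dr)$,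 where $\lambda_{\cdot,s'}$ is an s-finite kernel; one writes $\lambda_{x,s'}(dv,dr)=\rho(x-vs')\,d\mu(v,r|x-vs')$. Fix a macroscopic point $(z,s)$ such that the versions $\lambda$ are regular at $(z,s)$: the measure $(1+|v|)r^2\lambda_{z,s}(dv,dr)$ is finite, and $(z',s')\mapsto(1+|v|)r^2\lambda_{z',s'}(dv,dr)$ is continuous at $(z,s)$ for weak convergence (against bounded continuous functions). Put $$d\hat\mu_{z,s}(x,v,r)=dx\,\lambda_{z,s}(dv,dr)=\rho(z-vs)\,dx\,d\mu(v,r|z-vs),$$ $$d\tilde\mu_{z,s}(x,v,r)=dx\,\lambda_{z+x,s}(dv,dr)=\rho(z+x-vs)\,dx\,d\mu(v,r|z+x-vs),$$ and $d\hat\mu_{2,z,s}=r^2\,d\hat\mu_{z,s}$, $d\tilde\mu_{2,z,s}=r^2\,d\tilde\mu_{z,s}$. For $\varepsilon>0$ let $X^\varepsilon$ be a Poisson process on $\mathbb R^3$ with intensity measure $\varepsilon^{-1}\mu$, let $N^\varepsilon=\varepsilon\sum_{p\in X^\varepsilon}\delta_p$, and define $$H^{\varepsilon}_{z,s}(b)=H_{N^\varepsilon}(b+(z,s))-H_{N^\varepsilon}(z,s),\qquad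 H_{z,s}(b)=H_\mu(b+(z,s))-H_\mu(z,s),$$ $$\hat\eta^\varepsilon_{z,s}(b)=\varepsilon^{-1/2}\varepsilon^{-1}\bigl(H^{\varepsilon^2}_{z,s}(\varepsilon b)-H_{z,s}(\varepsilon b)\bigr),\qquad \tilde\eta^\varepsilon_{z,s}(b)=\varepsilon^{-1}\bigl(H^{\varepsilon^2}_{z,s}(b)-H_{z,s}(b)\bigr).$$ The Lévy–Chentsov field with distance $d$ is the centered Gaussian field $\eta$ on $\mathbb R^2$ with covariances $\mathrm{Cov}(\eta(a),\eta(b))=\tfrac12\bigl(d(o,a)+d(o,b)-d(a,b)\bigr)$. *Statement.* There are independent fields $\hat\eta_{z,s}$ and $\tilde\eta_{z,s}$, defined on a common probability space, which are Lévy–Chentsov fields with distances $\hat d(a,b)=\hat\mu_{2,z,s}(ab)$ and $\tilde d(a,b)=\tilde\mu_{2,z,s}(ab)$ respectively, such that, as $\varepsilon\to0$, $$(\hat\eta^\varepsilon_{z,s},\tilde\eta^\varepsilon_{z,s})\longrightarrow(\hat\eta_{z,s},\tilde\eta_{z,s})$$ jointly in law, in the sense of finite-dimensional distributions: for all finite sets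 $I,J\subset\mathbb R^2$ the random vector $\bigl((\hat\eta^\varepsilon_{z,s}(a))_{a\in I},(\tilde\eta^\varepsilon_{z,s}(b))_{b\in J}\bigr)$ converges in distribution to $\bigl((\hat\eta_{z,s}(a))_{a\in I},(\tilde\eta_{z,s}(b))_{b\in J}\bigr)$. -/

import Mathlib

open MeasureTheory ProbabilityTheory Filter Topology
open scoped ENNReal NNReal

noncomputable section

namespace Multitime

/-- The space-time plane: `(x, t)` is the point at position `x` and time `t`. -/
abbrev Plane : Type := ℝ × ℝ

/-- The space-velocity-mark space: `(x, v, r)` codifies a line with mark `r`. -/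
abbrev Marked : Type := ℝ × ℝ × ℝ

/-! ### Lines, half-planes and crossing sets -/

/-- The space-time line `{(x + v t, t) : t ∈ ℝ}` of the point `(x, v, r)`. -/
def line (p : Marked) : Set Plane := Set.range fun t : ℝ => (p.1 + p.2.1 * t, t)

/-- The right half-plane of the line, containing the line. -/
def rightHalf (p : Marked) : Set Plane := {c | p.1 + c.2 * p.2.1 ≤ c.1}

/-- The left half-plane of the line. -/
def leftHalf (p : Marked) : Set Plane := {c | c.1 < p.1 + c.2 * p.2.1}

/-- `ab`: the points whose line intersects the segment with extremes `a` and `b`. -/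
def cross (a b : Plane) : Set Marked := {p | (line p ∩ segment ℝ a b).Nonempty}

/-- `ab₊`: the points whose line has `a` on its left and `b` on its right. -/
def crossPos (a b : Plane) : Set Marked := {p | a ∈ leftHalf p ∧ b ∈ rightHalf p}

/-- `ab₋`: the points whose line has `a` on its right and `b` on its left. -/
def crossNeg (a b : Plane) : Set Marked := {p | a ∈ rightHalf p ∧ b ∈ leftHalf p}

/-! ### Measures on the space-velocity-mark space and the surfaces they generate -/

/-- `dμ₂(x, v, r) = r² dμ(x, v, r)`. -/
def secondMoment (μ : Measure Marked) : Measure Marked :=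
  μ.withDensity fun p => ENNReal.ofReal (p.2.2 ^ 2)

/-- The class of measures with `μ(ab) + μ₂(ab) < ∞` for all `a`, `b`. -/
def InM (μ : Measure Marked) : Prop :=
  ∀ a b : Plane, μ (cross a b) + secondMoment μ (cross a b) < ∞

/-- The elementary surface `r (1{ob₊} - 1{ob₋})` generated by the marked line `(x, v, r)`. -/
def step (b : Plane) (p : Marked) : ℝ :=
  p.2.2 * ((crossPos 0 b).indicator 1 p - (crossNeg 0 b).indicator 1 p)

/-- The surface `H_μ(b) = ∫ h_{x,v,r}(b) dμ(x, v, r)`; for an empirical measure it is the sum of the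
elementary surfaces of the points of the configuration. -/
def height (μ : Measure Marked) (b : Plane) : ℝ := ∫ p, step b p ∂μ

/-- The height of the surface at `(z, s) + b`, relative to the height at `(z, s)`. -/
def relHeight (μ : Measure Marked) (z s : ℝ) (b : Plane) : ℝ :=
  height μ (b + (z, s)) - height μ (z, s)

/-! ### Poisson processes and fluctuation fields -/

/-- The empirical (counting) measure of a configuration: `A ↦ |X ∩ A|`. -/
def empirical (X : Set Marked) : Measure Marked :=
  Measure.sum fun p : X => Measure.dirac (p : Marked)

/-- `X` is a Poisson process with intensity measure `μ`. -/
structure IsPoissonProcess {Ω : Type*} [MeasurableSpace Ω] (P : Measure Ω)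
    (X : Ω → Set Marked) (μ : Measure Marked) : Prop where
  measurable : ∀ A : Set Marked, MeasurableSet A → Measurable fun ω => empirical (X ω) A
  law : ∀ A : Set Marked, MeasurableSet A → μ A < ∞ →
    P.map (fun ω => empirical (X ω) A) =
      (poissonMeasure (μ A).toNNReal).map (Nat.cast : ℕ → ℝ≥0∞)
  indep : ∀ (n : ℕ) (A : Fin n → Set Marked), (∀ i, MeasurableSet (A i)) →
    Pairwise (fun i j => Disjoint (A i) (A j)) →
    iIndepFun (fun i ω => empirical (X ω) (A i)) P

/-- The rescaled empirical measure `N^ε = ε ∑_{p ∈ X} δ_p`. -/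
def scaledEmpirical (ε : ℝ) (X : Set Marked) : Measure Marked :=
  ENNReal.ofReal ε • empirical X

/-- The microscopic fluctuation field
`ε^{-1/2} ε^{-1} (H^{ε²}_{z,s}(ε b) - H_{z,s}(ε b))`; `X` is the configuration `X^{ε²}`. -/
def microField (μ : Measure Marked) (z s ε : ℝ) (X : Set Marked) (b : Plane) : ℝ :=
  ε ^ (-(1 / 2) : ℝ) * ε⁻¹ *
    (relHeight (scaledEmpirical (ε ^ 2) X) z s (ε • b) - relHeight μ z s (ε • b))

/-- The macroscopic fluctuation field
`ε^{-1} (H^{ε²}_{z,s}(b) - H_{z,s}(b))`; `X` is the configuration `X^{ε²}`. -/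
def macroField (μ : Measure Marked) (z s ε : ℝ) (X : Set Marked) (b : Plane) : ℝ :=
  ε⁻¹ * (relHeight (scaledEmpirical (ε ^ 2) X) z s b - relHeight μ z s b)

/-! ### Disintegration in the space coordinate -/

/-- The measure `ρ(x) dx dμ(v, r | x)`. -/
def ofDensity (ρ : ℝ → ℝ) (κ : Kernel ℝ (ℝ × ℝ)) : Measure Marked :=
  (volume.withDensity fun x => ENNReal.ofReal (ρ x)) ⊗ₘ κ

/-- The image of `μ` when every point `(x, v, r)` moves ballistically during a time `s`. -/
def flow (μ : Measure Marked) (s : ℝ) : Measure Marked :=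
  μ.map fun p => (p.1 + p.2.1 * s, p.2)

/-- `Λ s x` is a version of the velocity-mark measure `ρ(x - v s) dμ(v, r | x - v s)` seen at the
space-time point `(x, s)`, where `dμ = ρ(x) dx dμ(v, r | x)`. That is, for every time `s` and every
measurable `φ ≥ 0`,
`∫ φ(x + v s, v, r) dμ(x, v, r) = ∫ (∫ φ(x, v, r) Λ s x (dv, dr)) dx`. -/
structure IsLocalDensity (μ : Measure Marked) (Λ : ℝ → Kernel ℝ (ℝ × ℝ)) : Prop where
  sFinite : ∀ s, IsSFiniteKernel (Λ s)
  disintegration : ∀ s, flow μ s = (volume : Measure ℝ) ⊗ₘ Λ s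

/-- The local velocity-mark measure, weighted by `(1 + |v|) r²`, is finite at `(z, s)` and weakly
continuous there as a function of the space-time point. -/
structure RegularAt (Λ : ℝ → Kernel ℝ (ℝ × ℝ)) (z s : ℝ) : Prop where
  finite : ∫⁻ q, ENNReal.ofReal ((1 + |q.1|) * q.2 ^ 2) ∂(Λ s z) < ∞
  continuous : ∀ φ : BoundedContinuousFunction (ℝ × ℝ) ℝ≥0,
    Tendsto
      (fun c : Plane => ∫⁻ q, (φ q : ℝ≥0∞) * ENNReal.ofReal ((1 + |q.1|) * q.2 ^ 2) ∂(Λ c.2 c.1))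
      (𝓝 (z, s))
      (𝓝 (∫⁻ q, (φ q : ℝ≥0∞) * ENNReal.ofReal ((1 + |q.1|) * q.2 ^ 2) ∂(Λ s z)))

/-- `dx ρ(z - v s) dμ(v, r | z - v s)`: the measure frozen at the space-time point `(z, s)`. -/
def hatMeasure (Λ : ℝ → Kernel ℝ (ℝ × ℝ)) (z s : ℝ) : Measure Marked :=
  (volume : Measure ℝ).prod (Λ s z)

/-- `dx ρ(z + x - v s) dμ(v, r | z + x - v s)`: the measure seen from `(z, s)`. -/
def tildeMeasure (Λ : ℝ → Kernel ℝ (ℝ × ℝ)) (z s : ℝ) : Measure Marked :=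
  (volume : Measure ℝ) ⊗ₘ (Λ s).comap (fun x => z + x) (measurable_const_add z)

/-! ### Lévy–Chentsov fields -/

/-- The distance `(a, b) ↦ μ₂(ab)`. -/
def crossDist (μ : Measure Marked) (a b : Plane) : ℝ := (secondMoment μ (cross a b)).toReal

/-- `η` is a Lévy–Chentsov field with distance `d`: a centered Gaussian field with covariances
`(d(o, a) + d(o, b) - d(a, b)) / 2`. -/
structure IsLevyChentsov {Ω : Type*} [MeasurableSpace Ω] (P : Measure Ω)
    (η : Plane → Ω → ℝ) (d : Plane → Plane → ℝ) : Prop where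
  gaussian : IsGaussianProcess η P
  centered : ∀ a, ∫ ω, η a ω ∂P = 0
  covariance : ∀ a b, cov[η a, η b; P] = (d 0 a + d 0 b - d a b) / 2

/-! ### The scaling parameter -/

/-- Positive scaling parameters. -/
abbrev Scale : Type := Set.Ioi (0 : ℝ)

/-- The scale `ε²`. -/
def Scale.sq (ε : Scale) : Scale := ⟨(ε : ℝ) ^ 2, Set.mem_Ioi.2 (pow_pos (Set.mem_Ioi.1 ε.2) 2)⟩

/-- The filter `ε → 0`, `ε > 0`. -/
def Scale.toZero : Filter Scale := comap Subtype.val (𝓝 (0 : ℝ))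

end Multitime

end

/-!
Both fluctuation fields are integrals of elementary surfaces against a compensated Poisson process,
so their joint characteristic function is `exp ∫ (e^{if} - 1 - if) dν` for an explicit kernel `f`.
It converges to a Gaussian one as soon as the Gram matrix of the kernels converges and the integrals
of `f² min(1, |f|)` vanish.

By polarization, the inner products of the elementary surfaces in `L²(μ)` are the Lévy–Chentsov
covariances of the distance `μ₂(ab)`, so the Gram matrix of the macroscopic field does not depend on
`ε`. The mixed covariances are `O(√ε)`: a line crossing both a segment of length of order `ε` at
`(z, s)` and a macroscopic one only has to cross the former.

For the microscopic field, the limit of `ε⁻¹ μ₂` of the lines crossing a segment of size `ε` at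
`(z, s)` is needed. A horizontal translation of the segment by at most `ε²` changes this flux by
`O(ε²)`, and by Fubini its average over these translations is an average of fluxes through
horizontal segments of length `ε²`. The latter are integrals of the local density, which is
continuous at `(z, s)`.
-/

namespace Multitime

lemma tendsto_of_forall_le_add {ι : Type*} {𝓕 : Filter ι} {f e : ι → ℝ≥0∞} {L : ℝ≥0∞}
    (he : Tendsto e 𝓕 (𝓝 0)) (hl : ∀ l < L, ∀ᶠ i in 𝓕, l ≤ f i + e i)
    (hu : ∀ u > L, ∀ᶠ i in 𝓕, f i ≤ u + e i) : Tendsto f 𝓕 (𝓝 L) := by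
  refine tendsto_order.2 ⟨fun l hlL => ?_, fun u huL => ?_⟩
  · obtain ⟨l', hll', hl'L⟩ := exists_between hlL
    have hlim : Tendsto (fun i => l' - e i) 𝓕 (𝓝 (l' - 0)) :=
      ENNReal.Tendsto.sub tendsto_const_nhds he (Or.inr ENNReal.zero_ne_top)
    rw [tsub_zero] at hlim
    filter_upwards [hlim.eventually_const_lt hll', hl l' hl'L] with i hi hi'
    exact hi.trans_le (tsub_le_iff_right.2 hi')
  · obtain ⟨u', hLu', hu'u⟩ := exists_between huL
    have hlim : Tendsto (fun i => u' + e i) 𝓕 (𝓝 (u' + 0)) := tendsto_const_nhds.add he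
    rw [add_zero] at hlim
    filter_upwards [hlim.eventually_lt_const hu'u, hu u' hLu'] with i hi hi'
    exact hi'.trans_lt hi

lemma tendsto_sqrt_nhdsGT_zero : Tendsto (fun ε : ℝ => √ε) (𝓝[>] 0) (𝓝[>] 0) :=
  tendsto_nhdsWithin_iff.2
    ⟨(Real.continuous_sqrt.tendsto' 0 0 Real.sqrt_zero).mono_left nhdsWithin_le_nhds,
      eventually_mem_nhdsWithin.mono fun _ => Real.sqrt_pos.2⟩

lemma integrable_of_memLp_two_of_measure_support_lt_top {α : Type*} [MeasurableSpace α]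
    {m : Measure α} {f : α → ℝ} (hf : MemLp f 2 m) (hsupp : m (Function.support f) < ∞) :
    Integrable f m := by
  have := isFiniteMeasure_restrict.2 hsupp.ne
  exact (integrableOn_iff_integrable_of_support_subset subset_rfl).1
    ((hf.restrict (Function.support f)).integrable one_le_two)

lemma measurable_integral_of_measurable {α : Type*} [MeasurableSpace α] {f : α → ℝ}
    (hf : Measurable f) : Measurable fun m : Measure α => ∫ p, f p ∂m := by
  classical
  have habs : Measurable fun m : Measure α => ∫⁻ p, ‖f p‖ₑ ∂m :=
    Measure.measurable_lintegral (by fun_prop)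
  have hpos : Measurable fun m : Measure α => ∫⁻ p, ENNReal.ofReal (f p) ∂m :=
    Measure.measurable_lintegral (by fun_prop)
  have hneg : Measurable fun m : Measure α => ∫⁻ p, ENNReal.ofReal (-f p) ∂m :=
    Measure.measurable_lintegral (by fun_prop)
  have hite : (fun m : Measure α => ∫ p, f p ∂m) = fun m => if ∫⁻ p, ‖f p‖ₑ ∂m < ∞ then
      (∫⁻ p, ENNReal.ofReal (f p) ∂m).toReal - (∫⁻ p, ENNReal.ofReal (-f p) ∂m).toReal
      else 0 := by
    ext m
    split_ifs with h
    · exact integral_eq_lintegral_pos_part_sub_lintegral_neg_part ⟨hf.aestronglyMeasurable, h⟩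
    · exact integral_undef fun hi => h hi.2
  rw [hite]
  exact Measurable.ite (measurableSet_lt habs measurable_const)
    (hpos.ennreal_toReal.sub hneg.ennreal_toReal) measurable_const

lemma integral_comp_simpleFunc {α E : Type*} [MeasurableSpace α] [NormedAddCommGroup E]
    [NormedSpace ℝ E] [CompleteSpace E] {m : Measure α} {g : SimpleFunc α ℝ}
    (hg : Integrable g m) {F : ℝ → E} (hF : F 0 = 0) :
    ∫ p, F (g p) ∂m = ∑ c ∈ g.range, m.real (g ⁻¹' {c}) • F c := by
  rw [← SimpleFunc.map_integral g F hg hF, SimpleFunc.integral_eq_integral]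
  · rfl
  · rw [SimpleFunc.integrable_iff_finMeasSupp] at hg ⊢
    exact hg.map hF

lemma setLIntegral_mem_Icc {α : Type*} {mα : MeasurableSpace α} {ν : Measure α} {s : Set α}
    (hs : MeasurableSet s) {f : α → ℝ≥0∞} {l u : ℝ≥0∞} (hf : ∀ x ∈ s, f x ∈ Set.Icc l u) :
    ∫⁻ x in s, f x ∂ν ∈ Set.Icc (l * ν s) (u * ν s) := by
  rw [← setLIntegral_const, ← setLIntegral_const]
  exact ⟨setLIntegral_mono' hs fun x hx => (hf x hx).1,
    setLIntegral_mono' hs fun x hx => (hf x hx).2⟩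

lemma lintegral_setLIntegral_section {α β : Type*} {mα : MeasurableSpace α}
    {mβ : MeasurableSpace β} (ν : Measure α) [SFinite ν] (μ : Measure β) [SFinite μ]
    {S : Set (α × β)} (hS : MeasurableSet S) {f : β → ℝ≥0∞} (hf : Measurable f) :
    ∫⁻ w, ∫⁻ p in {p | (w, p) ∈ S}, f p ∂μ ∂ν = ∫⁻ p, f p * ν {w | (w, p) ∈ S} ∂μ := by
  calc ∫⁻ w, ∫⁻ p in {p | (w, p) ∈ S}, f p ∂μ ∂ν
      = ∫⁻ w, μ.withDensity f (Prod.mk w ⁻¹' S) ∂ν :=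
        lintegral_congr fun w => (withDensity_apply f (measurable_prodMk_left hS)).symm
    _ = ∫⁻ p, ν ((fun w => (w, p)) ⁻¹' S) ∂(μ.withDensity f) := by
        rw [← Measure.prod_apply hS, Measure.prod_apply_symm hS]
    _ = ∫⁻ p, f p * ν {w | (w, p) ∈ S} ∂μ :=
        lintegral_withDensity_eq_lintegral_mul μ hf (measurable_measure_prodMk_right hS)

lemma volume_preimage_lineMap {x y : ℝ} (hxy : x ≠ y) (S : Set ℝ) :
    ENNReal.ofReal |y - x| * volume ((AffineMap.lineMap x y : ℝ → ℝ) ⁻¹' S) = volume S := by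
  have hne : y - x ≠ 0 := sub_ne_zero.2 hxy.symm
  have h : (AffineMap.lineMap x y : ℝ → ℝ) ⁻¹' S =
      (fun θ => (y - x) * θ) ⁻¹' ((fun u => x + u) ⁻¹' S) := by
    ext θ
    simp only [Set.mem_preimage, AffineMap.lineMap_apply, smul_eq_mul, vsub_eq_sub, vadd_eq_add]
    rw [mul_comm, add_comm]
  rw [h, Real.volume_preimage_mul_left hne, measure_preimage_add, ← mul_assoc,
    ← ENNReal.ofReal_mul (abs_nonneg _), ← abs_mul, mul_inv_cancel₀ hne, abs_one,
    ENNReal.ofReal_one, one_mul]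

lemma volume_inter_uIoc (x y : ℝ) (S : Set ℝ) :
    volume (S ∩ Set.uIoc x y) =
      ENNReal.ofReal |y - x| * volume ((AffineMap.lineMap x y : ℝ → ℝ) ⁻¹' S ∩ Set.Icc 0 1) := by
  rcases eq_or_ne x y with rfl | hxy
  · simp
  have hIcc : (AffineMap.lineMap x y : ℝ → ℝ) ⁻¹' Set.uIcc x y = Set.Icc (0 : ℝ) 1 := by
    rw [← segment_eq_uIcc, segment_eq_image_lineMap,
      Set.preimage_image_eq _ (AffineMap.lineMap_injective ℝ hxy)]
  rw [← hIcc, ← Set.preimage_inter, volume_preimage_lineMap hxy]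
  exact measure_congr (ae_eq_rfl.inter uIoc_ae_eq_interval)

/-- Both sides measure the translations by at most `h` that bring a point of the interval to the
origin. -/
lemma volume_setOf_zero_mem_uIoc_add (x y : ℝ) {h : ℝ} (hh : 0 ≤ h) :
    volume ({w | 0 ∈ Set.uIoc (x + w) (y + w)} ∩ Set.Ioc 0 h) =
      ENNReal.ofReal |y - x| * volume ({θ : ℝ | 0 ∈ Set.uIoc (AffineMap.lineMap x y θ)
        (AffineMap.lineMap x y θ + h)} ∩ Set.Icc 0 1) := by
  have hl : {w | 0 ∈ Set.uIoc (x + w) (y + w)} ∩ Set.Ioc 0 h =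
      -(Set.Ico (-h) 0 ∩ Set.uIoc x y) := by
    ext w
    simp only [Set.mem_inter_iff, Set.mem_ofPred_eq, Set.mem_uIoc, Set.mem_Ioc, Set.mem_neg,
      Set.mem_Ico]
    grind
  have hr : {θ : ℝ | 0 ∈ Set.uIoc (AffineMap.lineMap x y θ) (AffineMap.lineMap x y θ + h)} =
      (AffineMap.lineMap x y : ℝ → ℝ) ⁻¹' Set.Ico (-h) 0 := by
    ext θ
    simp only [Set.mem_ofPred_eq, Set.mem_uIoc, Set.mem_preimage, Set.mem_Ico]
    grind
  rw [hl, hr, Measure.measure_neg, volume_inter_uIoc]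

section GaussianProcess

variable {Ω : Type*} [MeasurableSpace Ω] {P : Measure Ω}

lemma coeFn_sum_smul {ι : Type*} (s : Finset ι) (c : ι → ℝ) (X : ι → Lp ℝ 2 P) :
    ↑(∑ i ∈ s, c i • X i) =ᵐ[P] fun ω => ∑ i ∈ s, c i * X i ω := by
  have hsmul : ∀ᵐ ω ∂P, ∀ i ∈ s, (c i • X i : Lp ℝ 2 P) ω = c i * X i ω :=
    (Finset.eventually_all s).2 fun i _ => Lp.coeFn_smul (c i) (X i)
  filter_upwards [Lp.coeFn_finsetSum s fun i => c i • X i, hsmul] with ω hsum hω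
  rw [hsum, Finset.sum_apply, Finset.sum_congr rfl hω]

lemma hasGaussianLaw_of_forall_sum {ι : Type*} [Fintype ι] {X : Ω → ι → ℝ}
    (hX : ∀ c : ι → ℝ, HasGaussianLaw (fun ω => ∑ i, c i * X ω i) P) : HasGaussianLaw X P := by
  classical
  have hm : AEMeasurable X P := aemeasurable_pi_lambda _ fun i => by
    simpa [Pi.single_apply] using (hX (Pi.single i 1)).aemeasurable
  refine ⟨isGaussian_of_isGaussian_map fun L => ?_⟩
  rw [AEMeasurable.map_map_of_aemeasurable (by fun_prop) hm]
  convert! (hX fun i => L (Pi.single i 1)).isGaussian_map using 2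
  ext ω
  conv_lhs => rw [Function.comp_apply, ← Finset.univ_sum_single (X ω), map_sum]
  refine Finset.sum_congr rfl fun i _ => ?_
  rw [mul_comm, ← smul_eq_mul, ← map_smul, ← Pi.single_smul, smul_eq_mul, mul_one]

lemma hasGaussianLaw_comp {ι T : Type*} [Finite ι] {X : T → Ω → ℝ} (hX : IsGaussianProcess X P)
    (f : ι → T) : HasGaussianLaw (fun ω i => X (f i) ω) P := by
  have := Fintype.ofFinite ι
  let L : (↥(Finset.univ : Finset ι) → ℝ) →L[ℝ] ι → ℝ :=
    .pi fun i => .proj ⟨i, Finset.mem_univ i⟩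
  exact ((hX.comp_right f).hasGaussianLaw Finset.univ).map_fun L

lemma map_coeFn_eq_gaussianReal {Y : Lp ℝ 2 P} (hY : HasGaussianLaw Y P) (h0 : ∫ ω, Y ω ∂P = 0) :
    P.map Y = gaussianReal 0 (‖Y‖₊ ^ 2) := by
  have hm := Lp.aestronglyMeasurable Y
  have hvar : Var[Y; P] = ‖Y‖ ^ 2 := by
    rw [variance_of_integral_eq_zero hm.aemeasurable h0, ← real_inner_self_eq_norm_sq,
      L2.inner_def]
    simp [sq]
  rw [hY.map_eq_gaussianReal, h0, hvar]
  congr 1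
  exact NNReal.eq (by simp)

variable [IsProbabilityMeasure P]

lemma isClosed_setOf_map_eq_gaussianReal :
    IsClosed {Y : Lp ℝ 2 P | P.map Y = gaussianReal 0 (‖Y‖₊ ^ 2)} := by
  refine IsSeqClosed.isClosed fun Y Z hY hYZ => ?_
  have hmeas : ∀ Y : Lp ℝ 2 P, AEMeasurable Y P := fun Y => (Lp.aestronglyMeasurable Y).aemeasurable
  have hlaw := ((tendstoInMeasure_of_tendsto_Lp hYZ).tendstoInDistribution fun n => hmeas _).tendsto
  have := Measure.isProbabilityMeasure_map (hmeas Z)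
  refine Measure.ext_of_charFun (funext fun t => ?_)
  refine tendsto_nhds_unique (ProbabilityMeasure.tendsto_iff_tendsto_charFun.1 hlaw t) ?_
  simp only [ProbabilityMeasure.coe_mk, fun n => show P.map (Y n) = _ from hY n,
    charFun_gaussianReal]
  have hc : Continuous fun Y : Lp ℝ 2 P => Complex.exp
      (t * (0 : ℝ) * Complex.I - ((‖Y‖₊ ^ 2 : ℝ≥0) : ℝ) * t ^ 2 / 2) := by fun_prop
  exact (hc.tendsto Z).comp hYZ

variable {ι : Type*} {X : ι → Lp ℝ 2 P}

lemma orthonormal_of_iIndepFun_gaussianReal (hX : ∀ i, HasLaw (X i) (gaussianReal 0 1) P)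
    (hind : iIndepFun (fun i => ⇑(X i)) P) : Orthonormal ℝ X := by
  classical
  refine orthonormal_iff_ite.2 fun i j => ?_
  have hcov : inner ℝ (X i) (X j) = cov[X i, X j; P] := by
    rw [covariance_eq_sub (Lp.memLp _) (Lp.memLp _), (hX i).integral_eq, integral_id_gaussianReal,
      zero_mul, sub_zero, L2.inner_def]
    simp [mul_comm]
  rw [hcov]
  split_ifs with hij
  · rw [hij, covariance_self (hX j).aemeasurable, (hX j).variance_eq, variance_id_gaussianReal,
      NNReal.coe_one]
  · exact (hind.indepFun hij).covariance_eq_zero (Lp.memLp _) (Lp.memLp _)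

lemma map_coeFn_sum_smul_eq_gaussianReal (hX : ∀ i, HasLaw (X i) (gaussianReal 0 1) P)
    (hind : iIndepFun (fun i => ⇑(X i)) P) (s : Finset ι) (c : ι → ℝ) :
    P.map ↑(∑ i ∈ s, c i • X i) = gaussianReal 0 (‖∑ i ∈ s, c i • X i‖₊ ^ 2) := by
  have hco := coeFn_sum_smul s c X
  refine map_coeFn_eq_gaussianReal (HasGaussianLaw.congr ?_ hco.symm) ?_
  · have hs : HasGaussianLaw (fun ω (i : s) => X i ω) P :=
      (hind.precomp Subtype.val_injective).hasGaussianLaw fun i => (hX i).hasGaussianLaw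
    refine (hs.map_fun (∑ i : s, c i • ContinuousLinearMap.proj i)).congr (ae_of_all _ fun ω => ?_)
    simp [← Finset.sum_coe_sort s]
  · rw [integral_congr_ae hco, integral_finsetSum _ fun i _ =>
      ((Lp.memLp (X i)).integrable one_le_two).const_mul _]
    simp [integral_const_mul, (hX _).integral_eq]

theorem exists_gaussian_isometry (H : Type) [NormedAddCommGroup H] [InnerProductSpace ℝ H]
    [CompleteSpace H] :
    ∃ (Ω : Type) (_ : MeasurableSpace Ω) (P : Measure Ω) (_ : IsProbabilityMeasure P)
      (W : H →ₗᵢ[ℝ] Lp ℝ 2 P), ∀ h, P.map (W h) = gaussianReal 0 (‖W h‖₊ ^ 2) := by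
  obtain ⟨ι, b, -⟩ := exists_hilbertBasis ℝ H
  obtain ⟨Ω, _, P, Y, -, hY, hind, _⟩ := exists_iid ι (gaussianReal 0 1)
  have hmem : ∀ i, MemLp (Y i) 2 P := fun i => (hY i).hasGaussianLaw.memLp_two
  let X : ι → Lp ℝ 2 P := fun i => (hmem i).toLp
  have hX : ∀ i, HasLaw (X i) (gaussianReal 0 1) P := fun i => (hY i).congr (hmem i).coeFn_toLp
  have hXind : iIndepFun (fun i => ⇑(X i)) P := hind.congr fun i => (hmem i).coeFn_toLp.symm
  have hortho := (orthonormal_of_iIndepFun_gaussianReal hX hXind).orthogonalFamily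
  refine ⟨Ω, _, P, ‹_›, hortho.linearIsometry.comp b.repr.toLinearIsometry, fun h => ?_⟩
  exact isClosed_setOf_map_eq_gaussianReal.mem_of_tendsto (hortho.hasSum_linearIsometry (b.repr h))
    (.of_forall fun s => map_coeFn_sum_smul_eq_gaussianReal hX hXind s fun i => b.repr h i)

theorem exists_isGaussianProcess_covariance_eq_inner {H : Type} [NormedAddCommGroup H]
    [InnerProductSpace ℝ H] [CompleteSpace H] {T : Type*} (f : T → H) :
    ∃ (Ω : Type) (_ : MeasurableSpace Ω) (P : Measure Ω) (_ : IsProbabilityMeasure P)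
      (ξ : T → Ω → ℝ), IsGaussianProcess ξ P ∧
        (∀ t, ∫ ω, ξ t ω ∂P = 0) ∧ ∀ t u, cov[ξ t, ξ u; P] = inner ℝ (f t) (f u) := by
  obtain ⟨Ω, _, P, _, W, hW⟩ := exists_gaussian_isometry H
  have hlaw : ∀ h, HasLaw (W h) (gaussianReal 0 (‖W h‖₊ ^ 2)) P := fun h =>
    ⟨(Lp.aestronglyMeasurable _).aemeasurable, hW h⟩
  have hmean : ∀ h, ∫ ω, W h ω ∂P = 0 := fun h => by
    rw [(hlaw h).integral_eq, integral_id_gaussianReal]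
  refine ⟨Ω, _, P, ‹_›, fun t => W (f t), ⟨fun I => hasGaussianLaw_of_forall_sum fun c => ?_⟩,
    fun t => hmean _, fun t u => ?_⟩
  · have hco := coeFn_sum_smul Finset.univ c fun t : I => W (f t)
    have hsum : W (∑ t : I, c t • f t) = ∑ t : I, c t • W (f t) := by simp
    exact (hsum ▸ (hlaw _).hasGaussianLaw).congr hco
  · rw [covariance_eq_sub (Lp.memLp _) (Lp.memLp _), hmean, zero_mul, sub_zero,
      ← W.inner_map_map, L2.inner_def]
    simp [mul_comm]

end GaussianProcess

section CharFun

variable {Ω' K : Type*} [MeasurableSpace Ω'] {P' : Measure Ω'} [IsProbabilityMeasure P'] [Fintype K]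

lemma integral_exp_sum_of_hasGaussianLaw {Z : Ω' → K → ℝ} (hZ : HasGaussianLaw Z P')
    (hmean : ∀ k, ∫ ω, Z ω k ∂P' = 0) (t : K → ℝ) :
    ∫ ω, Complex.exp ((∑ k, t k * Z ω k : ℝ) * Complex.I) ∂P' = Complex.exp
      (-((∑ k, ∑ l, t k * t l * cov[fun ω => Z ω k, fun ω => Z ω l; P']) / 2 : ℝ)) := by
  have hmem : ∀ k, MemLp (fun ω => Z ω k) 2 P' := fun k => (hZ.eval k).memLp_two
  have hG : HasGaussianLaw (fun ω => ∑ k, t k * Z ω k) P' := by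
    simpa using hZ.map_fun (∑ k, t k • ContinuousLinearMap.proj (R := ℝ) (φ := fun _ : K => ℝ) k)
  have hG0 : ∫ ω, ∑ k, t k * Z ω k ∂P' = 0 := by
    rw [integral_finsetSum _ fun k _ => ((hmem k).integrable one_le_two).const_mul _]
    simp [integral_const_mul, hmean]
  have hvar : Var[fun ω => ∑ k, t k * Z ω k; P'] =
      ∑ k, ∑ l, t k * t l * cov[fun ω => Z ω k, fun ω => Z ω l; P'] := by
    rw [← covariance_self hG.aemeasurable, covariance_fun_sum_fun_sum
      (fun k => (hmem k).const_mul _) (fun k => (hmem k).const_mul _)]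
    refine Finset.sum_congr rfl fun k _ => Finset.sum_congr rfl fun l _ => ?_
    rw [covariance_const_mul_left, covariance_const_mul_right, mul_assoc]
  have hchar := hG.charFun_map_eq 1
  rw [charFun_apply_real, integral_map hG.aemeasurable (by fun_prop)] at hchar
  simpa [hG0, hvar, neg_div] using hchar

omit [IsProbabilityMeasure P'] in
lemma charFun_map_toLp {Z : Ω' → K → ℝ} (hZ : AEMeasurable Z P') (t : EuclideanSpace ℝ K) :
    charFun (P'.map fun ω => WithLp.toLp 2 (Z ω)) t =
      ∫ ω, Complex.exp ((∑ k, t k * Z ω k : ℝ) * Complex.I) ∂P' := by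
  rw [charFun_apply, integral_map (by fun_prop) (by fun_prop)]
  rfl

lemma tendstoInDistribution_of_tendsto_integral_exp {ι : Type*} {Ω : ι → Type*}
    [∀ i, MeasurableSpace (Ω i)] {P : ∀ i, Measure (Ω i)} [∀ i, IsProbabilityMeasure (P i)]
    {l : Filter ι} [l.IsCountablyGenerated] {Y : ∀ i, Ω i → K → ℝ} {Z : Ω' → K → ℝ}
    (hY : ∀ i, AEMeasurable (Y i) (P i)) (hZ : AEMeasurable Z P')
    (h : ∀ t : K → ℝ, Tendsto
      (fun i => ∫ ω, Complex.exp ((∑ k, t k * Y i ω k : ℝ) * Complex.I) ∂(P i)) l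
      (𝓝 (∫ ω, Complex.exp ((∑ k, t k * Z ω k : ℝ) * Complex.I) ∂P'))) :
    TendstoInDistribution Y l Z P P' := by
  have hlim : TendstoInDistribution (fun i ω => (WithLp.toLp 2 (Y i ω) : EuclideanSpace ℝ K)) l
      (fun ω => WithLp.toLp 2 (Z ω)) P P' :=
    ⟨fun i => by have := hY i; fun_prop, by fun_prop, tendsto_of_seq_tendsto fun x hx =>
      ProbabilityMeasure.tendsto_of_tendsto_charFun fun t => by
        have ht := (h t).comp hx
        rw [← charFun_map_toLp hZ] at ht
        exact ht.congr fun n => (charFun_map_toLp (hY (x n)) t).symm⟩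
  exact hlim.continuous_comp (g := WithLp.ofLp) (by fun_prop)

end CharFun

section Lindeberg

/-- The weight `x² min(1, |x|)` whose vanishing integral is the Lindeberg condition, in the form
suited to infinitely divisible laws. -/
noncomputable def lindebergWeight (x : ℝ) : ℝ := x ^ 2 * min 1 |x|

lemma lindebergWeight_nonneg (x : ℝ) : 0 ≤ lindebergWeight x := by
  unfold lindebergWeight
  positivity

lemma lindebergWeight_le_sq (x : ℝ) : lindebergWeight x ≤ x ^ 2 :=
  mul_le_of_le_one_right (sq_nonneg x) (min_le_left _ _)

@[fun_prop]
lemma measurable_lindebergWeight : Measurable lindebergWeight := by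
  unfold lindebergWeight
  fun_prop

lemma lindebergWeight_le_of_abs_le {x y : ℝ} (h : |x| ≤ |y|) :
    lindebergWeight x ≤ lindebergWeight y :=
  mul_le_mul (sq_le_sq.2 h) (min_le_min_left 1 h) (by positivity) (sq_nonneg y)

lemma lindebergWeight_mul_le (t x : ℝ) :
    lindebergWeight (t * x) ≤ t ^ 2 * max 1 |t| * lindebergWeight x := by
  have hmin : min 1 (|t| * |x|) ≤ max 1 |t| * min 1 |x| := by
    rw [mul_min_of_nonneg _ _ (by positivity), mul_one]
    exact min_le_min (le_max_left _ _) (by gcongr; exact le_max_right _ _)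
  calc lindebergWeight (t * x) = t ^ 2 * x ^ 2 * min 1 (|t| * |x|) := by
        rw [lindebergWeight, mul_pow, abs_mul]
    _ ≤ t ^ 2 * x ^ 2 * (max 1 |t| * min 1 |x|) := by gcongr
    _ = t ^ 2 * max 1 |t| * lindebergWeight x := by rw [lindebergWeight]; ring

lemma lindebergWeight_sum_le {K : Type*} (s : Finset K) (x : K → ℝ) :
    lindebergWeight (∑ k ∈ s, x k) ≤ (s.card : ℝ) ^ 3 * ∑ k ∈ s, lindebergWeight (x k) := by
  rcases s.eq_empty_or_nonempty with rfl | hs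
  · simp [lindebergWeight]
  obtain ⟨m, hm, hmax⟩ := s.exists_max_image (fun k => |x k|) hs
  have hcard : (1 : ℝ) ≤ |(s.card : ℝ)| := by
    rw [Nat.abs_cast]
    exact_mod_cast hs.card_pos
  have habs : |∑ k ∈ s, x k| ≤ |s.card * x m| := by
    rw [abs_mul, Nat.abs_cast, ← nsmul_eq_mul]
    exact (s.abs_sum_le_sum_abs x).trans (s.sum_le_card_nsmul _ _ hmax)
  calc lindebergWeight (∑ k ∈ s, x k) ≤ lindebergWeight (s.card * x m) :=
        lindebergWeight_le_of_abs_le habs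
    _ ≤ (s.card : ℝ) ^ 3 * lindebergWeight (x m) := by
        refine (lindebergWeight_mul_le _ _).trans_eq ?_
        rw [max_eq_right hcard, Nat.abs_cast]
        ring
    _ ≤ (s.card : ℝ) ^ 3 * ∑ k ∈ s, lindebergWeight (x k) := by
        gcongr
        exact Finset.single_le_sum (fun k _ => lindebergWeight_nonneg (x k)) hm

lemma norm_exp_mul_I_sub_one_le (x : ℝ) : ‖Complex.exp (x * Complex.I) - 1‖ ≤ |x| := by
  rw [mul_comm]
  exact Real.norm_exp_I_mul_ofReal_sub_one_le

lemma norm_exp_sub_taylor_le_of_abs_le_one {x : ℝ} (hx : |x| ≤ 1) :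
    ‖Complex.exp (x * Complex.I) - 1 - x * Complex.I + (x ^ 2 / 2 : ℝ)‖ ≤ |x| ^ 3 := by
  have h := Complex.exp_bound (x := x * Complex.I) (by simpa using hx) (n := 3) (by norm_num)
  have hsum : ∑ m ∈ Finset.range 3, (x * Complex.I) ^ m / (m.factorial : ℂ) =
      1 + x * Complex.I - (x ^ 2 / 2 : ℝ) := by
    simp only [Finset.sum_range_succ, Finset.sum_range_zero, Nat.factorial, mul_pow, Complex.I_sq]
    push_cast
    ring
  rw [hsum, norm_mul, Complex.norm_I, mul_one, Complex.norm_real, Real.norm_eq_abs] at h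
  calc _ = ‖Complex.exp (x * Complex.I) - (1 + x * Complex.I - (x ^ 2 / 2 : ℝ))‖ := by
        congr 1
        ring
    _ ≤ _ := h
    _ ≤ |x| ^ 3 := mul_le_of_le_one_right (by positivity) (by norm_num [Nat.factorial])

lemma norm_exp_sub_taylor_le (x : ℝ) :
    ‖Complex.exp (x * Complex.I) - 1 - x * Complex.I + (x ^ 2 / 2 : ℝ)‖ ≤
      3 * lindebergWeight x := by
  rcases le_total |x| 1 with hx | hx
  · refine (norm_exp_sub_taylor_le_of_abs_le_one hx).trans ?_
    rw [lindebergWeight, min_eq_right hx, ← sq_abs, ← pow_succ]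
    exact le_mul_of_one_le_left (by positivity) (by norm_num)
  · have hsq : |x| ≤ x ^ 2 := by
      rw [← sq_abs]
      exact le_self_pow₀ hx two_ne_zero
    calc _ ≤ ‖Complex.exp (x * Complex.I) - 1‖ + ‖(x : ℂ) * Complex.I‖ +
          ‖((x ^ 2 / 2 : ℝ) : ℂ)‖ := norm_add_le_of_le (norm_sub_le _ _) le_rfl
      _ ≤ |x| + |x| + x ^ 2 / 2 := by
          gcongr
          · exact norm_exp_mul_I_sub_one_le x
          · simp
          · rw [Complex.norm_real, Real.norm_of_nonneg (by positivity)]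
      _ ≤ 3 * lindebergWeight x := by
          rw [lindebergWeight, min_eq_left hx]
          linarith

variable {α : Type*} [MeasurableSpace α] {ν : Measure α} {f : α → ℝ}

lemma integrable_lindebergWeight (hf : MemLp f 2 ν) :
    Integrable (fun p => lindebergWeight (f p)) ν :=
  hf.integrable_sq.mono'
    (measurable_lindebergWeight.comp_aemeasurable hf.aemeasurable).aestronglyMeasurable
    (ae_of_all _ fun p => by
      rw [Real.norm_of_nonneg (lindebergWeight_nonneg _)]
      exact lindebergWeight_le_sq _)

lemma norm_integral_exp_sub_add_half_integral_sq_le (hf : MemLp f 2 ν) :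
    ‖∫ p, (Complex.exp (f p * Complex.I) - 1 - f p * Complex.I) ∂ν +
      ((∫ p, f p ^ 2 ∂ν) / 2 : ℝ)‖ ≤ 3 * ∫ p, lindebergWeight (f p) ∂ν := by
  have hL := (integrable_lindebergWeight hf).const_mul 3
  have hbound : ∀ᵐ p ∂ν, ‖Complex.exp (f p * Complex.I) - 1 - f p * Complex.I +
      (f p ^ 2 / 2 : ℝ)‖ ≤ 3 * lindebergWeight (f p) :=
    ae_of_all _ fun p => norm_exp_sub_taylor_le (f p)
  have hR : Integrable (fun p => Complex.exp (f p * Complex.I) - 1 - f p * Complex.I +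
      (f p ^ 2 / 2 : ℝ)) ν := by
    have := hf.aemeasurable
    exact hL.mono' (AEMeasurable.aestronglyMeasurable (by fun_prop)) hbound
  have hS : Integrable (fun p => ((f p ^ 2 / 2 : ℝ) : ℂ)) ν := (hf.integrable_sq.div_const 2).ofReal
  have hsplit : ∫ p, (Complex.exp (f p * Complex.I) - 1 - f p * Complex.I) ∂ν +
      ((∫ p, f p ^ 2 ∂ν) / 2 : ℝ) = ∫ p, (Complex.exp (f p * Complex.I) - 1 - f p * Complex.I +
      (f p ^ 2 / 2 : ℝ)) ∂ν := by
    have hE : Integrable (fun p => Complex.exp (f p * Complex.I) - 1 - f p * Complex.I) ν :=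
      (hR.sub hS).congr (ae_of_all _ fun p => by simp)
    rw [integral_add hE hS, ← integral_div, integral_complex_ofReal]
  rw [hsplit, ← integral_const_mul]
  exact norm_integral_le_of_norm_le hL hbound

lemma tendsto_integral_exp_sub {ι : Type*} {l : Filter ι} {ν : ι → Measure α} {f : ι → α → ℝ}
    (hf : ∀ i, MemLp (f i) 2 (ν i)) {V : ℝ}
    (hV : Tendsto (fun i => ∫ p, f i p ^ 2 ∂(ν i)) l (𝓝 V))
    (hL : Tendsto (fun i => ∫ p, lindebergWeight (f i p) ∂(ν i)) l (𝓝 0)) :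
    Tendsto (fun i => ∫ p, (Complex.exp (f i p * Complex.I) - 1 - f i p * Complex.I) ∂(ν i)) l
      (𝓝 (-(V / 2 : ℝ))) := by
  have hR := squeeze_zero_norm (fun i => norm_integral_exp_sub_add_half_integral_sq_le (hf i))
    (by simpa using hL.const_mul 3)
  simpa using hR.sub ((Complex.continuous_ofReal.tendsto _).comp (hV.div_const 2))

variable {K : Type*} [Fintype K]

lemma integral_sum_mul_sq {f : K → α → ℝ} (hf : ∀ k, MemLp (f k) 2 ν) (t : K → ℝ) :
    ∫ p, (∑ k, t k * f k p) ^ 2 ∂ν = ∑ k, ∑ l, t k * t l * ∫ p, f k p * f l p ∂ν := by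
  have hint : ∀ k l, Integrable (fun p => t k * t l * (f k p * f l p)) ν := fun k l =>
    ((hf k).integrable_mul (hf l)).const_mul _
  have hexpand : ∀ p, (∑ k, t k * f k p) ^ 2 = ∑ k, ∑ l, t k * t l * (f k p * f l p) := fun p => by
    rw [sq, Finset.sum_mul_sum]
    exact Finset.sum_congr rfl fun k _ => Finset.sum_congr rfl fun l _ => by ring
  simp_rw [hexpand]
  rw [integral_finsetSum _ fun k _ => integrable_finsetSum _ fun l _ => hint k l]
  simp_rw [integral_finsetSum _ fun l _ => hint _ l, integral_const_mul]

lemma integral_lindebergWeight_sum_le {f : K → α → ℝ} (hf : ∀ k, MemLp (f k) 2 ν) (t : K → ℝ) :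
    ∫ p, lindebergWeight (∑ k, t k * f k p) ∂ν ≤
      Fintype.card K ^ 3 * ∑ k, t k ^ 2 * max 1 |t k| * ∫ p, lindebergWeight (f k p) ∂ν := by
  have hint : ∀ k, Integrable (fun p => t k ^ 2 * max 1 |t k| * lindebergWeight (f k p)) ν :=
    fun k => (integrable_lindebergWeight (hf k)).const_mul _
  simp_rw [← integral_const_mul]
  rw [← integral_finsetSum _ fun k _ => hint k, ← integral_const_mul]
  refine integral_mono
    (integrable_lindebergWeight (memLp_finsetSum _ fun k _ => (hf k).const_mul (t k)))
    ((integrable_finsetSum _ fun k _ => hint k).const_mul _) fun p => ?_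
  refine (lindebergWeight_sum_le _ _).trans ?_
  rw [Finset.card_univ]
  gcongr with k
  exact lindebergWeight_mul_le _ _

end Lindeberg

section Poisson

lemma integrable_empirical {X : Set Marked} {f : Marked → ℝ} (hf : Measurable f)
    (hX : empirical X (Function.support f) < ∞) : Integrable f (empirical X) := by
  rw [empirical, Measure.sum_apply _ (measurableSet_support hf)] at hX
  have hfin := ENNReal.finite_const_le_of_tsum_ne_top hX.ne one_ne_zero
  have hsum : ∫⁻ p, ‖f p‖ₑ ∂(empirical X) = ∑' p : X, ‖f p‖ₑ := by
    simp [empirical, lintegral_sum_measure, lintegral_dirac' _ hf.enorm]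
  refine ⟨hf.aestronglyMeasurable, ?_⟩
  rw [HasFiniteIntegral, hsum, tsum_eq_sum (s := hfin.toFinset) fun p hp => by
    by_contra h
    exact hp (by
      have : f p ≠ 0 := by simpa using h
      simp [Measure.dirac_apply' _ (measurableSet_support hf), this])]
  exact ENNReal.sum_lt_top.2 fun p _ => enorm_lt_top

variable {Ω : Type*} [MeasurableSpace Ω] {P : Measure Ω} {X : Ω → Set Marked} {ν : Measure Marked}

/-- The compensated Poisson integral `∫ f d(∑_{p ∈ X} δ_p - ν)`; the fluctuation fields are of
this form. -/
noncomputable def compensatedIntegral (ν : Measure Marked) (X : Set Marked) (f : Marked → ℝ) : ℝ :=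
  ∫ p, f p ∂(empirical X) - ∫ p, f p ∂ν

namespace IsPoissonProcess

lemma measurable_integral (hX : IsPoissonProcess P X ν) {f : Marked → ℝ} (hf : Measurable f) :
    Measurable fun ω => ∫ p, f p ∂(empirical (X ω)) :=
  (measurable_integral_of_measurable hf).comp
    (Measure.measurable_of_measurable_coe _ hX.measurable)

lemma ae_lt_top (hX : IsPoissonProcess P X ν) {A : Set Marked} (hA : MeasurableSet A)
    (hνA : ν A < ∞) : ∀ᵐ ω ∂P, empirical (X ω) A < ∞ := by
  have h : ∀ᵐ x ∂(P.map fun ω => empirical (X ω) A), x < ∞ := by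
    rw [hX.law A hA hνA]
    exact (ae_map_iff (p := fun x => x < ∞) .of_discrete measurableSet_Iio).2
      (ae_of_all _ fun n => ENNReal.natCast_lt_top n)
  exact ae_of_ae_map (hX.measurable A hA).aemeasurable h

lemma ae_integrable (hX : IsPoissonProcess P X ν) {f : Marked → ℝ} (hf : Measurable f)
    (hsupp : ν (Function.support f) < ∞) : ∀ᵐ ω ∂P, Integrable f (empirical (X ω)) := by
  filter_upwards [hX.ae_lt_top (measurableSet_support hf) hsupp] with ω hω
  exact integrable_empirical hf hω

lemma ae_compensatedIntegral_sum (hX : IsPoissonProcess P X ν) {K : Type*} [Fintype K]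
    {f : K → Marked → ℝ} (hf : ∀ k, Measurable (f k)) (hsupp : ∀ k, ν (Function.support (f k)) < ∞)
    (hint : ∀ k, Integrable (f k) ν) (t : K → ℝ) :
    ∀ᵐ ω ∂P, compensatedIntegral ν (X ω) (fun p => ∑ k, t k * f k p) =
      ∑ k, t k * compensatedIntegral ν (X ω) (f k) := by
  filter_upwards [ae_all_iff.2 fun k => hX.ae_integrable (hf k) (hsupp k)] with ω hω
  simp only [compensatedIntegral, mul_sub, Finset.sum_sub_distrib]
  rw [integral_finsetSum _ fun k _ => (hω k).const_mul _,
    integral_finsetSum _ fun k _ => (hint k).const_mul _]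
  simp only [integral_const_mul]

lemma integral_exp_empirical (hX : IsPoissonProcess P X ν) {A : Set Marked}
    (hA : MeasurableSet A) (hνA : ν A < ∞) (c : ℝ) :
    ∫ ω, Complex.exp (((empirical (X ω)).real A * c : ℝ) * Complex.I) ∂P =
      Complex.exp (ν.real A * (Complex.exp (c * Complex.I) - 1)) := by
  have hm : Measurable fun ω => (empirical (X ω)).real A := (hX.measurable A hA).ennreal_toReal
  have hlaw : P.map (fun ω => (empirical (X ω)).real A) =
      (poissonMeasure (ν A).toNNReal).map (Nat.cast : ℕ → ℝ) := by
    change P.map (ENNReal.toReal ∘ fun ω => empirical (X ω) A) = _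
    rw [← Measure.map_map ENNReal.measurable_toReal (hX.measurable A hA), hX.law A hA hνA,
      Measure.map_map ENNReal.measurable_toReal .of_discrete]
    rfl
  have hchar := charFun_map_cast_poissonMeasure (ν A).toNNReal c
  rw [← hlaw, charFun_apply_real, integral_map hm.aemeasurable (by fun_prop)] at hchar
  rw [show ((ν.real A : ℝ) : ℂ) = (((ν A).toNNReal : ℝ) : ℂ) from rfl, ← hchar]
  congr with ω
  push_cast
  ring_nf

variable [IsProbabilityMeasure P]

lemma integral_exp_simpleFunc (hX : IsPoissonProcess P X ν) (g : SimpleFunc Marked ℝ)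
    (hsupp : ν (Function.support g) < ∞) :
    ∫ ω, Complex.exp ((∫ p, g p ∂(empirical (X ω)) : ℝ) * Complex.I) ∂P =
      Complex.exp (∫ p, (Complex.exp (g p * Complex.I) - 1) ∂ν) := by
  have hint : Integrable g ν :=
    SimpleFunc.integrable_iff_finMeasSupp.2 (SimpleFunc.finMeasSupp_iff_support.2 hsupp)
  have hfibre : ∀ c : g.range, ∫ ω, Complex.exp
      (((empirical (X ω)).real (g ⁻¹' {(c : ℝ)}) * c : ℝ) * Complex.I) ∂P =
        Complex.exp (ν.real (g ⁻¹' {(c : ℝ)}) • (Complex.exp (c * Complex.I) - 1)) := fun c => by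
    by_cases hc : (c : ℝ) = 0
    · simp [hc]
    · rw [Complex.real_smul]
      exact hX.integral_exp_empirical (g.measurableSet_fiber _)
        (SimpleFunc.integrable_iff.1 hint c hc) c
  have hind : iIndepFun (fun (c : g.range) ω => empirical (X ω) (g ⁻¹' {(c : ℝ)})) P := by
    have h := hX.indep _ (fun i => g ⁻¹' {((g.range.equivFin.symm i : g.range) : ℝ)})
      (fun i => g.measurableSet_fiber _) fun i j hij => Disjoint.preimage _ <| by
        rw [Set.disjoint_singleton]
        exact fun h => hij (g.range.equivFin.symm.injective (Subtype.ext h))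
    simpa using h.precomp g.range.equivFin.injective
  calc _ = ∫ ω, ∏ c : g.range, Complex.exp
        (((empirical (X ω)).real (g ⁻¹' {(c : ℝ)}) * c : ℝ) * Complex.I) ∂P := by
        refine integral_congr_ae ?_
        filter_upwards [hX.ae_integrable g.measurable hsupp] with ω hω
        rw [integral_comp_simpleFunc hω (F := fun x => x) rfl, ← Finset.sum_coe_sort,
          ← Complex.exp_sum, ← Finset.sum_mul, Complex.ofReal_sum]
        rfl
    _ = ∏ c : g.range, ∫ ω, Complex.exp
        (((empirical (X ω)).real (g ⁻¹' {(c : ℝ)}) * c : ℝ) * Complex.I) ∂P :=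
        hind.integral_fun_prod_comp (𝕜 := ℂ)
          (f := fun (c : g.range) (x : ℝ≥0∞) => Complex.exp ((x.toReal * c : ℝ) * Complex.I))
          (fun c => (hX.measurable _ (g.measurableSet_fiber _)).aemeasurable)
          (fun c => Measurable.aestronglyMeasurable (by fun_prop))
    _ = _ := by
        rw [integral_comp_simpleFunc hint (F := fun x : ℝ => Complex.exp (x * Complex.I) - 1)
          (by simp), ← Finset.sum_coe_sort, Complex.exp_sum]
        exact Finset.prod_congr rfl fun c _ => hfibre c

lemma tendsto_integral_exp_empirical (hX : IsPoissonProcess P X ν) {f : Marked → ℝ}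
    (hf : Measurable f) (hsupp : ν (Function.support f) < ∞) {g : ℕ → Marked → ℝ}
    (hg : ∀ n, Measurable (g n)) (hbound : ∀ n p, ‖g n p‖ ≤ 2 * ‖f p‖)
    (hlim : ∀ p, Tendsto (fun n => g n p) atTop (𝓝 (f p))) :
    Tendsto (fun n => ∫ ω, Complex.exp ((∫ p, g n p ∂(empirical (X ω)) : ℝ) * Complex.I) ∂P)
      atTop (𝓝 (∫ ω, Complex.exp ((∫ p, f p ∂(empirical (X ω)) : ℝ) * Complex.I) ∂P)) := by
  refine tendsto_integral_of_dominated_convergence (fun _ => (1 : ℝ)) (fun n => ?_)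
    (integrable_const _) (fun n => ae_of_all _ fun ω => (Complex.norm_exp_ofReal_mul_I _).le) ?_
  · have := hX.measurable_integral (hg n)
    exact Measurable.aestronglyMeasurable (by fun_prop)
  · filter_upwards [hX.ae_integrable hf hsupp] with ω hω
    have hN := tendsto_integral_of_dominated_convergence (fun p => 2 * ‖f p‖)
      (fun n => (hg n).aestronglyMeasurable) (hω.norm.const_mul 2)
      (fun n => ae_of_all _ (hbound n)) (ae_of_all _ hlim)
    exact (Continuous.tendsto (by fun_prop : Continuous fun x : ℝ =>
      Complex.exp (x * Complex.I)) _).comp hN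

theorem integral_exp_integral (hX : IsPoissonProcess P X ν) {f : Marked → ℝ} (hf : Measurable f)
    (hsupp : ν (Function.support f) < ∞) (hint : Integrable f ν) :
    ∫ ω, Complex.exp ((∫ p, f p ∂(empirical (X ω)) : ℝ) * Complex.I) ∂P =
      Complex.exp (∫ p, (Complex.exp (f p * Complex.I) - 1) ∂ν) := by
  let g : ℕ → SimpleFunc Marked ℝ := SimpleFunc.approxOn f hf Set.univ 0 (Set.mem_univ _)
  have hbound : ∀ n p, ‖g n p‖ ≤ 2 * ‖f p‖ := fun n p =>
    (SimpleFunc.norm_approxOn_zero_le hf (Set.mem_univ _) p n).trans_eq (two_mul _).symm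
  have hlim : ∀ p, Tendsto (fun n => g n p) atTop (𝓝 (f p)) := fun p =>
    SimpleFunc.tendsto_approxOn hf (Set.mem_univ _) (by simp)
  have hgsupp : ∀ n, ν (Function.support (g n)) < ∞ := fun n =>
    (measure_mono fun p (hp : g n p ≠ 0) (hfp : f p = 0) =>
      hp (by simpa [hfp] using hbound n p)).trans_lt hsupp
  have hexponent : Tendsto (fun n => ∫ p, (Complex.exp (g n p * Complex.I) - 1) ∂ν) atTop
      (𝓝 (∫ p, (Complex.exp (f p * Complex.I) - 1) ∂ν)) := by
    refine tendsto_integral_of_dominated_convergence (fun p => 2 * ‖f p‖) (fun n => ?_)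
      (hint.norm.const_mul 2)
      (fun n => ae_of_all _ fun p => (norm_exp_mul_I_sub_one_le _).trans (hbound n p))
      (ae_of_all _ fun p => (Continuous.tendsto (by fun_prop : Continuous fun x : ℝ =>
        Complex.exp (x * Complex.I) - 1) _).comp (hlim p))
    have := (g n).measurable
    exact Measurable.aestronglyMeasurable (by fun_prop)
  refine tendsto_nhds_unique
    (hX.tendsto_integral_exp_empirical hf hsupp (fun n => (g n).measurable) hbound hlim) ?_
  simp_rw [fun n => hX.integral_exp_simpleFunc (g n) (hgsupp n)]
  exact (Complex.continuous_exp.tendsto _).comp hexponent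

theorem integral_exp_compensatedIntegral (hX : IsPoissonProcess P X ν) {f : Marked → ℝ}
    (hf : Measurable f) (hsupp : ν (Function.support f) < ∞) (hint : Integrable f ν) :
    ∫ ω, Complex.exp (compensatedIntegral ν (X ω) f * Complex.I) ∂P =
      Complex.exp (∫ p, (Complex.exp (f p * Complex.I) - 1 - f p * Complex.I) ∂ν) := by
  have hexp : Integrable (fun p => Complex.exp (f p * Complex.I) - 1) ν :=
    hint.norm.mono' (Measurable.aestronglyMeasurable (by fun_prop))
      (ae_of_all _ fun p => norm_exp_mul_I_sub_one_le (f p))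
  have hI : Integrable (fun p => (f p : ℂ) * Complex.I) ν := hint.ofReal.mul_const _
  rw [integral_sub hexp hI, Complex.exp_sub, integral_mul_const,
    integral_complex_ofReal, ← hX.integral_exp_integral hf hsupp hint, ← integral_div]
  congr with ω
  rw [← Complex.exp_sub, compensatedIntegral, Complex.ofReal_sub, sub_mul]

lemma integral_exp_sum_compensatedIntegral (hX : IsPoissonProcess P X ν) {K : Type*} [Fintype K]
    {f : K → Marked → ℝ} (hf : ∀ k, Measurable (f k)) (hsupp : ∀ k, ν (Function.support (f k)) < ∞)
    (hint : ∀ k, Integrable (f k) ν) (t : K → ℝ) :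
    ∫ ω, Complex.exp ((∑ k, t k * compensatedIntegral ν (X ω) (f k) : ℝ) * Complex.I) ∂P =
      Complex.exp (∫ p, (Complex.exp ((∑ k, t k * f k p : ℝ) * Complex.I) - 1 -
        (∑ k, t k * f k p : ℝ) * Complex.I) ∂ν) := by
  have hsum : ν (Function.support fun p => ∑ k, t k * f k p) < ∞ := by
    refine (measure_mono fun p hp => ?_).trans_lt
      ((measure_iUnion_fintype_le ν _).trans_lt (ENNReal.sum_lt_top.2 fun k _ => hsupp k))
    obtain ⟨k, -, hk⟩ := Finset.exists_ne_zero_of_sum_ne_zero hp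
    exact Set.mem_iUnion.2 ⟨k, right_ne_zero_of_mul hk⟩
  rw [← hX.integral_exp_compensatedIntegral (by fun_prop) hsum
    (integrable_finsetSum _ fun k _ => (hint k).const_mul _)]
  refine integral_congr_ae ?_
  filter_upwards [hX.ae_compensatedIntegral_sum hf hsupp hint t] with ω hω
  rw [hω]

end IsPoissonProcess

theorem tendstoInDistribution_compensatedIntegral {ι : Type*} {l : Filter ι}
    [l.IsCountablyGenerated] {Ω : ι → Type*} [∀ i, MeasurableSpace (Ω i)] {P : ∀ i, Measure (Ω i)}
    [∀ i, IsProbabilityMeasure (P i)] {X : ∀ i, Ω i → Set Marked} {ν : ι → Measure Marked}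
    (hX : ∀ i, IsPoissonProcess (P i) (X i) (ν i)) {K : Type*} [Finite K]
    {f : ι → K → Marked → ℝ} (hf : ∀ i k, Measurable (f i k))
    (hmem : ∀ i k, MemLp (f i k) 2 (ν i)) (hsupp : ∀ i k, ν i (Function.support (f i k)) < ∞)
    {Ω' : Type*} [MeasurableSpace Ω'] {P' : Measure Ω'} [IsProbabilityMeasure P']
    {Z : Ω' → K → ℝ} (hZ : HasGaussianLaw Z P') (hmean : ∀ k, ∫ ω, Z ω k ∂P' = 0)
    (hcov : ∀ k m, Tendsto (fun i => ∫ p, f i k p * f i m p ∂(ν i)) l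
      (𝓝 cov[fun ω => Z ω k, fun ω => Z ω m; P']))
    (hlindeberg : ∀ k, Tendsto (fun i => ∫ p, lindebergWeight (f i k p) ∂(ν i)) l (𝓝 0)) :
    TendstoInDistribution (fun i ω k => compensatedIntegral (ν i) (X i ω) (f i k)) l Z P P' := by
  have := Fintype.ofFinite K
  refine tendstoInDistribution_of_tendsto_integral_exp (fun i => ?_) hZ.aemeasurable fun t => ?_
  · exact (measurable_pi_lambda _ fun k =>
      ((hX i).measurable_integral (hf i k)).sub_const _).aemeasurable
  have hvar : Tendsto (fun i => ∫ p, (∑ k, t k * f i k p) ^ 2 ∂(ν i)) l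
      (𝓝 (∑ k, ∑ m, t k * t m * cov[fun ω => Z ω k, fun ω => Z ω m; P'])) := by
    simp_rw [integral_sum_mul_sq (hmem _)]
    exact tendsto_finsetSum _ fun k _ => tendsto_finsetSum _ fun m _ => (hcov k m).const_mul _
  have hsmall : Tendsto (fun i => ∫ p, lindebergWeight (∑ k, t k * f i k p) ∂(ν i)) l (𝓝 0) := by
    refine squeeze_zero (fun i => integral_nonneg fun p => lindebergWeight_nonneg _)
      (fun i => integral_lindebergWeight_sum_le (hmem i) t) ?_
    simpa using (tendsto_finsetSum _ fun k _ => (hlindeberg k).const_mul _).const_mul _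
  have hexponent := tendsto_integral_exp_sub
    (fun i => memLp_finsetSum _ fun k _ => (hmem i k).const_mul (t k)) hvar hsmall
  rw [integral_exp_sum_of_hasGaussianLaw hZ hmean]
  refine ((Complex.continuous_exp.tendsto _).comp hexponent).congr fun i => ?_
  exact ((hX i).integral_exp_sum_compensatedIntegral (hf i) (hsupp i) (fun k =>
    integrable_of_memLp_two_of_measure_support_lt_top (hmem i k) (hsupp i k)) t).symm

end Poisson

/-- The signed horizontal displacement from the line of `p` to the point `a`; it is nonnegative
exactly when `a` is to the right of the line. -/
def offset (a : Plane) (p : Marked) : ℝ := a.1 - (p.1 + a.2 * p.2.1)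

/-- The marked lines passing through `a`. -/
def onLine (a : Plane) : Set Marked := {p | offset a p = 0}

/-- The marked lines having `a` and `b` on different sides; it differs from `cross a b` by lines
through `a` or `b`. -/
def sep (a b : Plane) : Set Marked := crossPos a b ∪ crossNeg a b

/-- The indicator of the marked lines having `a` on their right. -/
noncomputable def side (a : Plane) : Marked → ℝ := {p | 0 ≤ offset a p}.indicator 1

/-- The height at `a` relative to `c` of the elementary surface of a marked line. -/
noncomputable def jump (c a : Plane) (p : Marked) : ℝ := p.2.2 * (side a p - side c p)

@[fun_prop]
lemma measurable_offset (a : Plane) : Measurable (offset a) := by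
  unfold offset; fun_prop

@[fun_prop]
lemma measurable_side (a : Plane) : Measurable (side a) :=
  measurable_one.indicator (measurableSet_le measurable_const (measurable_offset a))

@[fun_prop]
lemma measurable_jump (c a : Plane) : Measurable (jump c a) := by
  unfold jump; fun_prop

lemma measurableSet_onLine (a : Plane) : MeasurableSet (onLine a) :=
  measurableSet_eq_fun (measurable_offset a) measurable_const

lemma mem_crossPos_iff {a b : Plane} {p : Marked} :
    p ∈ crossPos a b ↔ offset a p < 0 ∧ 0 ≤ offset b p := by
  simp [crossPos, leftHalf, rightHalf, offset]

lemma mem_crossNeg_iff {a b : Plane} {p : Marked} :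
    p ∈ crossNeg a b ↔ 0 ≤ offset a p ∧ offset b p < 0 := by
  simp [crossNeg, leftHalf, rightHalf, offset]

lemma mem_sep_iff {a b : Plane} {p : Marked} :
    p ∈ sep a b ↔ offset a p < 0 ∧ 0 ≤ offset b p ∨ 0 ≤ offset a p ∧ offset b p < 0 := by
  rw [sep, Set.mem_union, mem_crossPos_iff, mem_crossNeg_iff]

lemma mem_sep_iff_mem_uIoc {a b : Plane} {p : Marked} :
    p ∈ sep a b ↔ 0 ∈ Set.uIoc (offset a p) (offset b p) := by
  rw [mem_sep_iff, Set.mem_uIoc, and_comm (a := 0 ≤ offset a p)]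

lemma measurableSet_sep (a b : Plane) : MeasurableSet (sep a b) := by
  have h : sep a b = {p | offset a p < 0 ∧ 0 ≤ offset b p ∨ 0 ≤ offset a p ∧ offset b p < 0} :=
    Set.ext fun p => mem_sep_iff
  rw [h]
  measurability

lemma sep_comm (a b : Plane) : sep a b = sep b a := by
  ext p; rw [mem_sep_iff_mem_uIoc, mem_sep_iff_mem_uIoc, Set.uIoc_comm]

lemma sep_subset_union (a b c : Plane) : sep a b ⊆ sep a c ∪ sep c b := by
  intro p
  simp only [Set.mem_union, mem_sep_iff]
  rcases lt_or_ge (offset c p) 0 with h | h <;> grind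

lemma offset_lineMap (a b : Plane) (θ : ℝ) (p : Marked) :
    offset (AffineMap.lineMap a b θ) p = AffineMap.lineMap (offset a p) (offset b p) θ := by
  simp only [offset, AffineMap.lineMap_apply_module, Prod.fst_add, Prod.snd_add, Prod.smul_fst,
    Prod.smul_snd, smul_eq_mul]
  ring

lemma mem_line_iff {c : Plane} {p : Marked} : c ∈ line p ↔ offset c p = 0 := by
  simp only [line, offset, Set.mem_range, Prod.ext_iff]
  grind

lemma mem_cross_iff {a b : Plane} {p : Marked} : p ∈ cross a b ↔ offset a p * offset b p ≤ 0 := by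
  have h : p ∈ cross a b ↔ 0 ∈ segment ℝ (offset a p) (offset b p) := by
    simp only [cross, Set.Nonempty, Set.mem_ofPred_eq, Set.mem_inter_iff, mem_line_iff,
      segment_eq_image_lineMap, Set.mem_image, ← offset_lineMap]
    grind
  rw [h, segment_eq_uIcc, Set.mem_uIcc, mul_nonpos_iff]
  tauto

lemma measurableSet_cross (a b : Plane) : MeasurableSet (cross a b) := by
  have h : cross a b = {p | offset a p * offset b p ≤ 0} := Set.ext fun p => mem_cross_iff
  rw [h]
  exact measurableSet_le (by fun_prop) measurable_const

lemma step_eq_jump (b : Plane) : step b = jump 0 b := by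
  ext p
  simp only [step, jump, side, Set.indicator, mem_crossPos_iff, mem_crossNeg_iff, Pi.one_apply,
    Set.mem_ofPred_eq]
  grind

lemma jump_sub_jump (a b c : Plane) (p : Marked) : jump c a p - jump c b p = jump b a p := by
  simp only [jump]; ring

lemma abs_jump (c a : Plane) (p : Marked) :
    |jump c a p| = (sep c a).indicator (fun p => |p.2.2|) p := by
  by_cases h : p ∈ sep c a
  · rw [Set.indicator_of_mem h]
    rcases mem_sep_iff.1 h with ⟨hc, ha⟩ | ⟨hc, ha⟩ <;>
      simp [jump, side, ha, hc, not_le.2]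
  · rw [Set.indicator_of_notMem h]
    rw [mem_sep_iff] at h
    simp only [jump, side, Set.indicator, Set.mem_ofPred_eq]
    grind

lemma jump_sq (c a : Plane) (p : Marked) :
    jump c a p ^ 2 = (sep c a).indicator (fun p => p.2.2 ^ 2) p := by
  rw [← sq_abs, abs_jump]
  by_cases h : p ∈ sep c a <;> simp [h]

lemma jump_mul_jump (c a b : Plane) (p : Marked) :
    jump c a p * jump c b p = (jump c a p ^ 2 + jump c b p ^ 2 - jump a b p ^ 2) / 2 := by
  rw [← jump_sub_jump b a c]; ring

/-- Measures that do not charge the lines through a given point and give a finite second moment to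
the crossing sets: the class of measures for which `crossDist` is the squared `L²` distance of the
elementary surfaces. -/
structure IsCrossRegular (ν : Measure Marked) : Prop where
  null : ∀ a, ν (onLine a) = 0
  finite : ∀ a b, secondMoment ν (cross a b) < ∞

lemma lintegral_jump_sq (ν : Measure Marked) (a b : Plane) :
    ∫⁻ p, ENNReal.ofReal (jump a b p ^ 2) ∂ν = secondMoment ν (sep a b) := by
  rw [secondMoment, withDensity_apply _ (measurableSet_sep a b),
    ← lintegral_indicator (measurableSet_sep a b)]
  congr with p
  rw [jump_sq]
  by_cases h : p ∈ sep a b <;> simp [h]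

lemma cross_ae_eq_sep {ν : Measure Marked} (hν : ∀ a, ν (onLine a) = 0) (a b : Plane) :
    cross a b =ᵐ[ν] sep a b := by
  have h : ∀ c, ∀ᵐ p ∂ν, offset c p ≠ 0 := fun c => measure_eq_zero_iff_ae_notMem.1 (hν c)
  rw [eventuallyEq_set]
  filter_upwards [h a, h b] with p ha hb
  rw [mem_cross_iff, mem_sep_iff, mul_nonpos_iff]
  grind

lemma lintegral_jump_sq_eq_secondMoment_cross {ν : Measure Marked}
    (hν : ∀ a, ν (onLine a) = 0) (a b : Plane) :
    ∫⁻ p, ENNReal.ofReal (jump a b p ^ 2) ∂ν = secondMoment ν (cross a b) := by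
  rw [lintegral_jump_sq]
  exact measure_congr ((withDensity_absolutelyContinuous ν _).ae_eq (cross_ae_eq_sep hν a b)).symm

namespace IsCrossRegular

variable {ν : Measure Marked} (hν : IsCrossRegular ν)
include hν

lemma integrable_jump_sq (a b : Plane) : Integrable (fun p => jump a b p ^ 2) ν := by
  refine ⟨by fun_prop, ?_⟩
  rw [hasFiniteIntegral_iff_ofReal (ae_of_all _ fun p => sq_nonneg _),
    lintegral_jump_sq_eq_secondMoment_cross hν.null]
  exact hν.finite a b

lemma memLp_jump (a b : Plane) : MemLp (jump a b) 2 ν :=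
  (memLp_two_iff_integrable_sq (by fun_prop)).2 (hν.integrable_jump_sq a b)

lemma integral_jump_sq (a b : Plane) : ∫ p, jump a b p ^ 2 ∂ν = crossDist ν a b := by
  rw [integral_eq_lintegral_of_nonneg_ae (ae_of_all _ fun p => sq_nonneg _) (by fun_prop),
    lintegral_jump_sq_eq_secondMoment_cross hν.null, crossDist]

lemma integral_jump_mul_jump (c a b : Plane) : ∫ p, jump c a p * jump c b p ∂ν =
    (crossDist ν c a + crossDist ν c b - crossDist ν a b) / 2 := by
  have hc := hν.integrable_jump_sq
  simp_rw [jump_mul_jump]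
  rw [integral_div, integral_sub (by exact (hc c a).add (hc c b)) (hc a b),
    integral_add (hc c a) (hc c b)]
  simp only [hν.integral_jump_sq]

end IsCrossRegular

/-- The total weight `∫ g(v, r)` of the lines separating two points; `g` is a function of the
velocity and the mark. -/
noncomputable def flux (μ : Measure Marked) (g : ℝ × ℝ → ℝ≥0∞) (A B : Plane) : ℝ≥0∞ :=
  ∫⁻ p in sep A B, g p.2 ∂μ

/-- The integral of a function of the velocity and the mark with respect to the local density at a
space-time point. -/
noncomputable def localIntegral (Λ : ℝ → Kernel ℝ (ℝ × ℝ)) (g : ℝ × ℝ → ℝ≥0∞) (c : Plane) :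
    ℝ≥0∞ :=
  ∫⁻ q, g q ∂(Λ c.2 c.1)

/-- The horizontal displacement from `a` to `b` in the frame moving at velocity `v`. -/
def drift (a b : Plane) (v : ℝ) : ℝ := b.1 - a.1 - v * (b.2 - a.2)

/-- The motion of the marked lines that moves `(z, s)` to the origin. -/
def recenter (z s : ℝ) (p : Marked) : Marked := (p.1 + p.2.1 * s - z, p.2)

@[fun_prop]
lemma continuous_drift (a b : Plane) : Continuous (drift a b) := by
  unfold drift; fun_prop

@[fun_prop]
lemma measurable_recenter (z s : ℝ) : Measurable (recenter z s) := by
  unfold recenter; fun_prop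

lemma offset_sub_offset (a b : Plane) (p : Marked) :
    offset b p - offset a p = drift a b p.2.1 := by
  simp only [offset, drift]; ring

lemma offset_add_prod_zero (A : Plane) (w : ℝ) (p : Marked) :
    offset (A + (w, 0)) p = offset A p + w := by
  simp only [offset, Prod.fst_add, Prod.snd_add, add_zero]; ring

lemma offset_recenter (z s : ℝ) (a : Plane) (p : Marked) :
    offset a (recenter z s p) = offset (a + (z, s)) p := by
  simp only [offset, recenter, Prod.fst_add, Prod.snd_add]; ring

lemma abs_drift_le (a b : Plane) (v : ℝ) :
    |drift a b v| ≤ (|b.1 - a.1| + |b.2 - a.2|) * (1 + |v|) := by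
  have h : |drift a b v| ≤ |b.1 - a.1| + |v| * |b.2 - a.2| := by
    rw [drift, ← abs_mul]; exact abs_sub _ _
  nlinarith [abs_nonneg (b.1 - a.1), abs_nonneg (b.2 - a.2), abs_nonneg v]

lemma volume_sep (a b : Plane) (q : ℝ × ℝ) :
    volume {x : ℝ | (x, q) ∈ sep a b} = ENNReal.ofReal |drift a b q.1| := by
  have h : {x : ℝ | (x, q) ∈ sep a b} = Set.uIoc (offset a (0, q)) (offset b (0, q)) := by
    ext x
    simp only [mem_sep_iff_mem_uIoc, Set.mem_ofPred_eq, Set.mem_uIoc, offset]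
    grind
  rw [h, Real.volume_uIoc, offset_sub_offset]

lemma flux_comm (μ : Measure Marked) (g : ℝ × ℝ → ℝ≥0∞) (A B : Plane) :
    flux μ g A B = flux μ g B A := by
  rw [flux, flux, sep_comm]

lemma flux_triangle (μ : Measure Marked) (g : ℝ × ℝ → ℝ≥0∞) (A B C : Plane) :
    flux μ g A B ≤ flux μ g A C + flux μ g C B :=
  (lintegral_mono_set (sep_subset_union A B C)).trans (lintegral_union_le _ _ _)

lemma flux_quadrilateral (μ : Measure Marked) (g : ℝ × ℝ → ℝ≥0∞) (A B A' B' : Plane) :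
    flux μ g A B ≤ flux μ g A A' + flux μ g A' B' + flux μ g B B' := by
  rw [flux_comm μ g B B']
  calc flux μ g A B
      ≤ flux μ g A B' + flux μ g B' B := flux_triangle μ g A B B'
    _ ≤ flux μ g A A' + flux μ g A' B' + flux μ g B' B := by
        gcongr; exact flux_triangle μ g A B' A'

lemma secondMoment_sep (μ : Measure Marked) (a b : Plane) :
    secondMoment μ (sep a b) = flux μ (fun q => ENNReal.ofReal (q.2 ^ 2)) a b :=
  withDensity_apply _ (measurableSet_sep a b)

lemma flux_prod (κ : Measure (ℝ × ℝ)) [SFinite κ] (a b : Plane) {g : ℝ × ℝ → ℝ≥0∞}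
    (hg : Measurable g) :
    flux ((volume : Measure ℝ).prod κ) g a b = ∫⁻ q, g q * ENNReal.ofReal |drift a b q.1| ∂κ := by
  have hs := measurableSet_sep a b
  rw [flux, ← lintegral_indicator hs, lintegral_prod_symm' _
    ((show Measurable fun p : Marked => g p.2 from hg.comp measurable_snd).indicator hs)]
  refine lintegral_congr fun q => ?_
  rw [← volume_sep]
  exact lintegral_indicator_const (measurable_prodMk_right hs) (g q)

lemma flux_prod_lt_top {κ : Measure (ℝ × ℝ)} [SFinite κ]
    (hκ : ∫⁻ q, ENNReal.ofReal ((1 + |q.1|) * q.2 ^ 2) ∂κ < ∞) (a b : Plane) :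
    flux ((volume : Measure ℝ).prod κ) (fun q => ENNReal.ofReal (q.2 ^ 2)) a b < ∞ := by
  rw [flux_prod κ a b (by fun_prop)]
  calc ∫⁻ q, ENNReal.ofReal (q.2 ^ 2) * ENNReal.ofReal |drift a b q.1| ∂κ
      ≤ ∫⁻ q, ENNReal.ofReal (|b.1 - a.1| + |b.2 - a.2|) *
          ENNReal.ofReal ((1 + |q.1|) * q.2 ^ 2) ∂κ := by
        refine lintegral_mono fun q => ?_
        rw [← ENNReal.ofReal_mul (sq_nonneg _), ← ENNReal.ofReal_mul (by positivity)]
        refine ENNReal.ofReal_le_ofReal ?_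
        nlinarith [mul_le_mul_of_nonneg_left (abs_drift_le a b q.1) (sq_nonneg q.2)]
    _ < ∞ := by
        rw [lintegral_const_mul _ (by fun_prop)]
        exact ENNReal.mul_lt_top ENNReal.ofReal_lt_top hκ

lemma isCrossRegular_prod {κ : Measure (ℝ × ℝ)} [SFinite κ]
    (hκ : ∫⁻ q, ENNReal.ofReal ((1 + |q.1|) * q.2 ^ 2) ∂κ < ∞) :
    IsCrossRegular ((volume : Measure ℝ).prod κ) := by
  have hnull (a : Plane) : ((volume : Measure ℝ).prod κ) (onLine a) = 0 := by
    rw [Measure.prod_apply_symm (measurableSet_onLine a)]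
    refine (lintegral_congr fun q => ?_).trans lintegral_zero
    have h : (fun x : ℝ => (x, q)) ⁻¹' onLine a = {offset a (0, q)} := by
      ext x
      simp only [onLine, offset, Set.mem_preimage, Set.mem_ofPred_eq, Set.mem_singleton_iff]
      grind
    rw [h, Real.volume_singleton]
  refine ⟨hnull, fun a b => ?_⟩
  rw [← lintegral_jump_sq_eq_secondMoment_cross hnull, lintegral_jump_sq, secondMoment_sep]
  exact flux_prod_lt_top hκ a b

namespace IsLocalDensity

variable {μ : Measure Marked} {Λ : ℝ → Kernel ℝ (ℝ × ℝ)} (hΛ : IsLocalDensity μ Λ)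
include hΛ

lemma sFinite_measure : SFinite μ := by
  have h : flow μ 0 = μ := by simp [flow]
  have := hΛ.sFinite 0
  rw [← h, hΛ.disintegration]
  infer_instance

lemma measure_onLine (a : Plane) : μ (onLine a) = 0 := by
  have := hΛ.sFinite a.2
  have h : ∀ᵐ p ∂flow μ a.2, p.1 ≠ a.1 := by
    rw [hΛ.disintegration]
    exact Measure.ae_compProd_of_ae_fst _ (measurableSet_singleton a.1).compl
      (Measure.ae_ne volume a.1)
  rw [measure_eq_zero_iff_ae_notMem]
  filter_upwards [ae_of_ae_map (by fun_prop) h] with p hp hline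
  simp only [onLine, offset, Set.mem_ofPred_eq] at hline
  grind

lemma isCrossRegular (hM : InM μ) : IsCrossRegular μ where
  null := hΛ.measure_onLine
  finite a b := le_add_self.trans_lt (hM a b)

lemma tildeMeasure_eq_map (z s : ℝ) : tildeMeasure Λ z s = μ.map (recenter z s) := by
  have := hΛ.sFinite s
  have hτ : Measurable fun p : Marked => ((p.1 - z, p.2) : Marked) := by fun_prop
  have hflow : μ.map (recenter z s) = (flow μ s).map fun p => (p.1 - z, p.2) := by
    rw [flow, Measure.map_map hτ (by fun_prop)]; rfl
  ext A hA
  rw [hflow, hΛ.disintegration, tildeMeasure, Measure.map_apply hτ hA, Measure.compProd_apply hA,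
    Measure.compProd_apply (hτ hA)]
  refine Eq.trans (lintegral_congr fun x => ?_) (lintegral_add_left_eq_self _ z)
  simp [Kernel.comap_apply, ← Set.preimage_comp, Function.comp_def]

lemma secondMoment_tildeMeasure (z s : ℝ) (a b : Plane) :
    secondMoment (tildeMeasure Λ z s) (cross a b) =
      secondMoment μ (cross (a + (z, s)) (b + (z, s))) := by
  have h : recenter z s ⁻¹' cross a b = cross (a + (z, s)) (b + (z, s)) := by
    ext p; simp only [Set.mem_preimage, mem_cross_iff, offset_recenter]
  rw [secondMoment, secondMoment, withDensity_apply _ (measurableSet_cross _ _),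
    withDensity_apply _ (measurableSet_cross _ _), hΛ.tildeMeasure_eq_map,
    setLIntegral_map (measurableSet_cross _ _) (by fun_prop) (by fun_prop), h]
  rfl

lemma isCrossRegular_tildeMeasure (hM : InM μ) (z s : ℝ) :
    IsCrossRegular (tildeMeasure Λ z s) where
  null a := by
    have h : recenter z s ⁻¹' onLine a = onLine (a + (z, s)) := by
      ext p; simp only [Set.mem_preimage, onLine, Set.mem_ofPred_eq, offset_recenter]
    rw [hΛ.tildeMeasure_eq_map, Measure.map_apply (by fun_prop) (measurableSet_onLine a), h]
    exact hΛ.measure_onLine _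
  finite a b := by
    rw [hΛ.secondMoment_tildeMeasure]
    exact (hΛ.isCrossRegular hM).finite _ _

lemma flux_horizontal {g : ℝ × ℝ → ℝ≥0∞} (hg : Measurable g) {x y : ℝ} (hxy : x ≤ y) (t : ℝ) :
    flux μ g (x, t) (y, t) = ∫⁻ u in Set.Ioc x y, localIntegral Λ g (u, t) := by
  have := hΛ.sFinite t
  have hs : MeasurableSet (Set.Ioc x y ×ˢ (Set.univ : Set (ℝ × ℝ))) :=
    measurableSet_Ioc.prod MeasurableSet.univ
  have hsep : sep (x, t) (y, t) =
      (fun p : Marked => (p.1 + p.2.1 * t, p.2)) ⁻¹' Set.Ioc x y ×ˢ Set.univ := by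
    ext p
    simp only [mem_sep_iff, offset, Set.mem_preimage, Set.mem_prod, Set.mem_Ioc, Set.mem_univ]
    grind
  have hcomp := Measure.setLIntegral_compProd (μ := volume) (κ := Λ t)
    (f := fun p : Marked => g p.2) (by fun_prop) (measurableSet_Ioc (a := x) (b := y))
    MeasurableSet.univ
  simp only [Measure.restrict_univ] at hcomp
  simp only [localIntegral]
  rw [flux, hsep, ← hcomp, ← hΛ.disintegration, flow,
    setLIntegral_map hs (by fun_prop) (by fun_prop)]

end IsLocalDensity

lemma lintegral_flux (μ : Measure Marked) [SFinite μ] (ν : Measure ℝ) [SFinite ν]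
    {g : ℝ × ℝ → ℝ≥0∞} (hg : Measurable g) {A B : ℝ → Plane} (hA : Measurable A)
    (hB : Measurable B) :
    ∫⁻ w, flux μ g (A w) (B w) ∂ν =
      ∫⁻ p, g p.2 * ν {w | 0 ∈ Set.uIoc (offset (A w) p) (offset (B w) p)} ∂μ := by
  have hS : MeasurableSet {x : ℝ × Marked | x.2 ∈ sep (A x.1) (B x.1)} := by
    have hoffset {C : ℝ → Plane} (hC : Measurable C) :
        Measurable fun x : ℝ × Marked => offset (C x.1) x.2 := by
      unfold offset; fun_prop
    simp only [mem_sep_iff]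
    exact ((measurableSet_lt (hoffset hA) measurable_const).inter
      (measurableSet_le measurable_const (hoffset hB))).union
      ((measurableSet_le measurable_const (hoffset hA)).inter
      (measurableSet_lt (hoffset hB) measurable_const))
  simp only [← mem_sep_iff_mem_uIoc]
  exact lintegral_setLIntegral_section ν μ hS (hg.comp measurable_snd)

lemma setLIntegral_flux_translate (μ : Measure Marked) [SFinite μ] {g : ℝ × ℝ → ℝ≥0∞}
    (hg : Measurable g) (A B : Plane) {h : ℝ} (hh : 0 ≤ h) :
    ∫⁻ w in Set.Ioc 0 h, flux μ g (A + (w, 0)) (B + (w, 0)) =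
      ∫⁻ θ in Set.Icc (0 : ℝ) 1, flux μ (fun q => g q * ENNReal.ofReal |drift A B q.1|)
        (AffineMap.lineMap A B θ) (AffineMap.lineMap A B θ + (h, 0)) := by
  have hcont : Continuous (AffineMap.lineMap A B : ℝ → Plane) := AffineMap.lineMap_continuous
  rw [lintegral_flux μ _ hg (by fun_prop) (by fun_prop),
    lintegral_flux μ _ (by fun_prop) hcont.measurable (by fun_prop)]
  refine lintegral_congr fun p => ?_
  simp only [offset_add_prod_zero, offset_lineMap]
  rw [Measure.restrict_apply' measurableSet_Ioc, Measure.restrict_apply' measurableSet_Icc,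
    volume_setOf_zero_mem_uIoc_add _ _ hh, offset_sub_offset, mul_assoc]

lemma drift_smul_add (ε : ℝ) (a b c : Plane) (v : ℝ) :
    drift (ε • a + c) (ε • b + c) v = ε * drift a b v := by
  simp only [drift, Prod.fst_add, Prod.snd_add, Prod.smul_fst, Prod.smul_snd, smul_eq_mul]
  ring

namespace IsLocalDensity

variable {μ : Measure Marked} {Λ : ℝ → Kernel ℝ (ℝ × ℝ)} (hΛ : IsLocalDensity μ Λ)
include hΛ

lemma flux_horizontal_mem_Icc {g : ℝ × ℝ → ℝ≥0∞} (hg : Measurable g) {A : Plane} {w : ℝ}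
    (hw : 0 ≤ w) {l u : ℝ≥0∞}
    (h : ∀ y ∈ Set.Ioc 0 w, localIntegral Λ g (A + (y, 0)) ∈ Set.Icc l u) :
    flux μ g A (A + (w, 0)) ∈ Set.Icc (l * ENNReal.ofReal w) (u * ENNReal.ofReal w) := by
  have hA : A + (w, 0) = (A.1 + w, A.2) := by ext <;> simp
  have hflux := hΛ.flux_horizontal hg (le_add_of_nonneg_right hw) A.2 (x := A.1)
  have hmem : ∀ y ∈ Set.Ioc A.1 (A.1 + w), localIntegral Λ g (y, A.2) ∈ Set.Icc l u := by
    intro y hy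
    have hy' := h (y - A.1) ⟨sub_pos.2 hy.1, sub_le_iff_le_add'.2 hy.2⟩
    rwa [show A + (y - A.1, 0) = (y, A.2) by ext <;> simp] at hy'
  rw [hA, hflux]
  simpa using setLIntegral_mem_Icc (ν := volume) measurableSet_Ioc hmem

lemma flux_translate_mem_Icc {g : ℝ × ℝ → ℝ≥0∞} (hg : Measurable g) {A B : Plane} {h : ℝ}
    {M : ℝ≥0∞} (hA : ∀ y ∈ Set.Ioc 0 h, localIntegral Λ g (A + (y, 0)) ≤ M)
    (hB : ∀ y ∈ Set.Ioc 0 h, localIntegral Λ g (B + (y, 0)) ≤ M) {w : ℝ} (hw : w ∈ Set.Ioc 0 h) :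
    flux μ g (A + (w, 0)) (B + (w, 0)) ≤ flux μ g A B + 2 * M * ENNReal.ofReal h ∧
      flux μ g A B ≤ flux μ g (A + (w, 0)) (B + (w, 0)) + 2 * M * ENNReal.ofReal h := by
  have hend {D : Plane} (hD : ∀ y ∈ Set.Ioc 0 h, localIntegral Λ g (D + (y, 0)) ≤ M) :
      flux μ g D (D + (w, 0)) ≤ M * ENNReal.ofReal h := by
    have hy := hΛ.flux_horizontal_mem_Icc hg hw.1.le
      fun y hy => ⟨zero_le, hD y ⟨hy.1, hy.2.trans hw.2⟩⟩
    exact hy.2.trans (by gcongr; exact hw.2)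
  have hsum (F : ℝ≥0∞) : M * ENNReal.ofReal h + F + M * ENNReal.ofReal h =
      F + 2 * M * ENNReal.ofReal h := by ring
  rw [← hsum, ← hsum]
  constructor
  · refine (flux_quadrilateral μ g _ _ A B).trans ?_
    rw [flux_comm μ g (A + (w, 0)) A, flux_comm μ g (B + (w, 0)) B]
    gcongr <;> exact hend ‹_›
  · refine (flux_quadrilateral μ g _ _ (A + (w, 0)) (B + (w, 0))).trans ?_
    gcongr <;> exact hend ‹_›

lemma setLIntegral_flux_translate_mem_Icc {g : ℝ × ℝ → ℝ≥0∞} (hg : Measurable g) {A B : Plane}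
    {h : ℝ} (hh : 0 ≤ h) {l u : ℝ≥0∞}
    (hseg : ∀ θ ∈ Set.Icc (0 : ℝ) 1, ∀ y ∈ Set.Ioc 0 h,
      localIntegral Λ (fun q => g q * ENNReal.ofReal |drift A B q.1|)
        (AffineMap.lineMap A B θ + (y, 0)) ∈ Set.Icc l u) :
    ∫⁻ w in Set.Ioc 0 h, flux μ g (A + (w, 0)) (B + (w, 0)) ∈
      Set.Icc (l * ENNReal.ofReal h) (u * ENNReal.ofReal h) := by
  have := hΛ.sFinite_measure
  rw [setLIntegral_flux_translate μ hg A B hh]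
  simpa using setLIntegral_mem_Icc (ν := volume) measurableSet_Icc fun θ hθ =>
    hΛ.flux_horizontal_mem_Icc (by fun_prop) hh (hseg θ hθ)

/-- Averaged over the horizontal translations of the segment by at most `h`, the flux is an average
of the local density along the segment, and these translations change the flux by `O(h)`. -/
lemma flux_mem_Icc {g : ℝ × ℝ → ℝ≥0∞} (hg : Measurable g) {A B : Plane} {h : ℝ} (hh : 0 < h)
    {l u M : ℝ≥0∞}
    (hseg : ∀ θ ∈ Set.Icc (0 : ℝ) 1, ∀ y ∈ Set.Ioc 0 h,
      localIntegral Λ (fun q => g q * ENNReal.ofReal |drift A B q.1|)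
        (AffineMap.lineMap A B θ + (y, 0)) ∈ Set.Icc l u)
    (hM : ∀ θ ∈ Set.Icc (0 : ℝ) 1, ∀ y ∈ Set.Ioc 0 h,
      localIntegral Λ g (AffineMap.lineMap A B θ + (y, 0)) ≤ M) :
    l ≤ flux μ g A B + 2 * M * ENNReal.ofReal h ∧
      flux μ g A B ≤ u + 2 * M * ENNReal.ofReal h := by
  have hA := hM 0 ⟨le_rfl, zero_le_one⟩
  have hB := hM 1 ⟨zero_le_one, le_rfl⟩
  rw [AffineMap.lineMap_apply_zero] at hA
  rw [AffineMap.lineMap_apply_one] at hB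
  have htrans := fun w => hΛ.flux_translate_mem_Icc hg hA hB (w := w)
  have havg := hΛ.setLIntegral_flux_translate_mem_Icc hg hh.le hseg
  have hconst (c : ℝ≥0∞) : ∫⁻ _ in Set.Ioc 0 h, c = c * ENNReal.ofReal h := by simp
  have hcancel {c d : ℝ≥0∞} (hcd : c * ENNReal.ofReal h ≤ d * ENNReal.ofReal h) : c ≤ d :=
    (ENNReal.mul_le_mul_iff_left (by simpa using hh) ENNReal.ofReal_ne_top).1 hcd
  refine ⟨hcancel (havg.1.trans ?_), hcancel ?_⟩
  · rw [← hconst]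
    exact setLIntegral_mono' measurableSet_Ioc fun w hw => (htrans w hw).1
  · rw [← hconst, add_mul]
    refine (setLIntegral_mono' measurableSet_Ioc fun w hw => (htrans w hw).2).trans ?_
    rw [lintegral_add_right _ measurable_const, hconst]
    gcongr
    exact havg.2

lemma flux_smul_div_mem_Icc {g : ℝ × ℝ → ℝ≥0∞} (hg : Measurable g) {a b c : Plane} {ε : ℝ}
    (hε : 0 < ε) {l u M : ℝ≥0∞}
    (hseg : ∀ θ ∈ Set.Icc (0 : ℝ) 1, ∀ y ∈ Set.Ioc 0 (ε ^ 2),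
      localIntegral Λ (fun q => g q * ENNReal.ofReal |drift a b q.1|)
        (AffineMap.lineMap (ε • a + c) (ε • b + c) θ + (y, 0)) ∈ Set.Icc l u)
    (hM : ∀ θ ∈ Set.Icc (0 : ℝ) 1, ∀ y ∈ Set.Ioc 0 (ε ^ 2),
      localIntegral Λ g (AffineMap.lineMap (ε • a + c) (ε • b + c) θ + (y, 0)) ≤ M) :
    l ≤ flux μ g (ε • a + c) (ε • b + c) / ENNReal.ofReal ε + 2 * M * ENNReal.ofReal ε ∧
      flux μ g (ε • a + c) (ε • b + c) / ENNReal.ofReal ε ≤ u + 2 * M * ENNReal.ofReal ε := by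
  have hε0 : ENNReal.ofReal ε ≠ 0 := by simpa using hε
  have hdrift (c' : Plane) :
      localIntegral Λ (fun q => g q * ENNReal.ofReal |drift (ε • a + c) (ε • b + c) q.1|) c' =
        localIntegral Λ (fun q => g q * ENNReal.ofReal |drift a b q.1|) c' * ENNReal.ofReal ε := by
    rw [localIntegral, localIntegral, ← lintegral_mul_const _ (by fun_prop)]
    refine lintegral_congr fun q => ?_
    rw [drift_smul_add, abs_mul, abs_of_pos hε, ENNReal.ofReal_mul hε.le]
    ring
  have hbounds := hΛ.flux_mem_Icc hg (pow_pos hε 2) (A := ε • a + c) (B := ε • b + c)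
    (l := l * ENNReal.ofReal ε) (u := u * ENNReal.ofReal ε) (fun θ hθ y hy => by
      rw [hdrift]
      exact ⟨by gcongr; exact (hseg θ hθ y hy).1, by gcongr; exact (hseg θ hθ y hy).2⟩) hM
  rw [sq, ENNReal.ofReal_mul hε.le, ← mul_assoc] at hbounds
  rw [ENNReal.div_le_iff hε0 ENNReal.ofReal_ne_top, add_mul]
  refine ⟨?_, hbounds.2⟩
  rw [← ENNReal.mul_le_mul_iff_left hε0 ENNReal.ofReal_ne_top, add_mul,
    ENNReal.div_mul_cancel hε0 ENNReal.ofReal_ne_top]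
  exact hbounds.1

end IsLocalDensity

lemma eventually_forall_lineMap_add {Q : Plane → Prop} {c : Plane} (hQ : ∀ᶠ x in 𝓝 c, Q x)
    (a b : Plane) : ∀ᶠ ε : ℝ in 𝓝[>] 0, ∀ θ ∈ Set.Icc (0 : ℝ) 1, ∀ y ∈ Set.Ioc 0 (ε ^ 2),
      Q (AffineMap.lineMap (ε • a + c) (ε • b + c) θ + (y, 0)) := by
  have hcont : Continuous fun x : ℝ × ℝ × ℝ =>
      AffineMap.lineMap (x.1 • a + c) (x.1 • b + c) x.2.1 + (x.1 ^ 2 * x.2.2, (0 : ℝ)) := by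
    simp only [AffineMap.lineMap_apply_module]; fun_prop
  have hev : ∀ᶠ ε : ℝ in 𝓝 0, ∀ x ∈ Set.Icc (0 : ℝ) 1 ×ˢ Set.Icc (0 : ℝ) 1,
      Q (AffineMap.lineMap (ε • a + c) (ε • b + c) x.1 + (ε ^ 2 * x.2, 0)) := by
    refine (isCompact_Icc.prod isCompact_Icc).eventually_forall_of_forall_eventually fun x _ => ?_
    refine hcont.continuousAt.eventually ?_
    simpa [show ((0 : ℝ), (0 : ℝ)) = 0 from rfl] using hQ
  filter_upwards [hev.filter_mono nhdsWithin_le_nhds, self_mem_nhdsWithin] with ε hε hε0 θ hθ y hy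
  have hε2 : 0 < ε ^ 2 := pow_pos hε0 2
  have h := hε (θ, y / ε ^ 2) ⟨hθ, div_nonneg hy.1.le hε2.le, div_le_one_of_le₀ hy.2 hε2.le⟩
  rwa [mul_div_cancel₀ _ hε2.ne'] at h

namespace RegularAt

variable {Λ : ℝ → Kernel ℝ (ℝ × ℝ)} {z s : ℝ} (hreg : RegularAt Λ z s)
include hreg

lemma tendsto_localIntegral {g : ℝ × ℝ → ℝ≥0} (hg : Continuous g) {C : ℝ≥0}
    (hC : ∀ q, g q ≤ C * (1 + ‖q.1‖₊)) :
    Tendsto (localIntegral Λ fun q => g q * ENNReal.ofReal (q.2 ^ 2)) (𝓝 (z, s))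
      (𝓝 (localIntegral Λ (fun q => g q * ENNReal.ofReal (q.2 ^ 2)) (z, s))) := by
  have hpos (q : ℝ × ℝ) : (1 + ‖q.1‖₊ : ℝ≥0) ≠ 0 := by positivity
  have hmem (q : ℝ × ℝ) : ((g q / (1 + ‖q.1‖₊) : ℝ≥0) : ℝ) ∈ Set.Icc 0 (C : ℝ) :=
    ⟨NNReal.coe_nonneg _, NNReal.coe_le_coe.2 (div_le_of_le_mul₀ zero_le zero_le (hC q))⟩
  let φ : BoundedContinuousFunction (ℝ × ℝ) ℝ≥0 := BoundedContinuousFunction.mkOfBound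
    ⟨fun q => g q / (1 + ‖q.1‖₊), hg.div (by fun_prop) hpos⟩ C fun q q' => by
      exact (Real.dist_le_of_mem_Icc (hmem q) (hmem q')).trans_eq (sub_zero _)
  have hφ (q : ℝ × ℝ) : (φ q : ℝ≥0∞) * ENNReal.ofReal ((1 + |q.1|) * q.2 ^ 2) =
      g q * ENNReal.ofReal (q.2 ^ 2) := by
    have hv : ENNReal.ofReal (1 + |q.1|) = ((1 + ‖q.1‖₊ : ℝ≥0) : ℝ≥0∞) := by
      rw [← ENNReal.ofReal_coe_nnreal]; simp
    rw [ENNReal.ofReal_mul (by positivity), hv, ← mul_assoc, ← ENNReal.coe_mul]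
    congr 2
    exact div_mul_cancel₀ _ (hpos q)
  unfold localIntegral
  simpa only [hφ] using hreg.continuous φ

lemma localIntegral_lt_top {g : ℝ × ℝ → ℝ≥0} {C : ℝ≥0} (hC : ∀ q, g q ≤ C) :
    localIntegral Λ (fun q => g q * ENNReal.ofReal (q.2 ^ 2)) (z, s) < ∞ := by
  calc ∫⁻ q, (g q : ℝ≥0∞) * ENNReal.ofReal (q.2 ^ 2) ∂(Λ s z)
      ≤ ∫⁻ q, (C : ℝ≥0∞) * ENNReal.ofReal ((1 + |q.1|) * q.2 ^ 2) ∂(Λ s z) := by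
        gcongr with q
        · exact hC q
        · nlinarith [abs_nonneg q.1, sq_nonneg q.2]
    _ < ∞ := by
        rw [lintegral_const_mul _ (by fun_prop)]
        exact ENNReal.mul_lt_top ENNReal.coe_lt_top hreg.finite

lemma tendsto_localIntegral_mul_drift {g : ℝ × ℝ → ℝ≥0} (hg : Continuous g) {C : ℝ≥0}
    (hC : ∀ q, g q ≤ C) (a b : Plane) :
    Tendsto (localIntegral Λ fun q => g q * ENNReal.ofReal (q.2 ^ 2) *
        ENNReal.ofReal |drift a b q.1|) (𝓝 (z, s))
      (𝓝 (localIntegral Λ (fun q => g q * ENNReal.ofReal (q.2 ^ 2) *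
        ENNReal.ofReal |drift a b q.1|) (z, s))) := by
  have hdrift (q : ℝ × ℝ) : (g q : ℝ≥0∞) * ENNReal.ofReal (q.2 ^ 2) *
      ENNReal.ofReal |drift a b q.1| =
        (g q * ‖drift a b q.1‖₊ : ℝ≥0) * ENNReal.ofReal (q.2 ^ 2) := by
    rw [← Real.norm_eq_abs, ofReal_norm, ENNReal.coe_mul, enorm_eq_nnnorm]
    ring
  simp only [hdrift]
  refine hreg.tendsto_localIntegral (by fun_prop)
    (C := C * (‖b.1 - a.1‖₊ + ‖b.2 - a.2‖₊)) fun q => ?_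
  rw [mul_assoc]
  exact mul_le_mul (hC q) (abs_drift_le a b q.1) zero_le zero_le

lemma tendsto_flux {μ : Measure Marked} (hΛ : IsLocalDensity μ Λ) {g : ℝ × ℝ → ℝ≥0}
    (hg : Continuous g) {C : ℝ≥0} (hC : ∀ q, g q ≤ C) (a b : Plane) :
    Tendsto (fun ε : ℝ => flux μ (fun q => g q * ENNReal.ofReal (q.2 ^ 2))
        (ε • a + (z, s)) (ε • b + (z, s)) / ENNReal.ofReal ε) (𝓝[>] 0)
      (𝓝 (flux (hatMeasure Λ z s) (fun q => g q * ENNReal.ofReal (q.2 ^ 2)) a b)) := by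
  have := hΛ.sFinite s
  have hCv (q : ℝ × ℝ) : g q ≤ C * (1 + ‖q.1‖₊) :=
    (hC q).trans (le_mul_of_one_le_right zero_le le_self_add)
  obtain ⟨M, hM, hMtop⟩ := exists_between (hreg.localIntegral_lt_top hC)
  have hlim := hreg.tendsto_localIntegral_mul_drift hg hC a b
  have hbdd := (hreg.tendsto_localIntegral hg hCv).eventually_le_const hM
  have herr : Tendsto (fun ε : ℝ => 2 * M * ENNReal.ofReal ε) (𝓝[>] 0) (𝓝 0) := by
    have h : Tendsto ENNReal.ofReal (𝓝[>] 0) (𝓝 0) :=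
      (ENNReal.continuous_ofReal.tendsto' 0 0 ENNReal.ofReal_zero).mono_left nhdsWithin_le_nhds
    simpa using ENNReal.Tendsto.const_mul (a := 2 * M) h
      (Or.inr (ENNReal.mul_ne_top ENNReal.ofNat_ne_top hMtop.ne))
  rw [hatMeasure, flux_prod _ a b (by fun_prop)]
  refine tendsto_of_forall_le_add herr (fun l hl => ?_) fun u hu => ?_
  · filter_upwards [eventually_forall_lineMap_add (hlim.eventually_const_le hl) a b,
      eventually_forall_lineMap_add hbdd a b, self_mem_nhdsWithin] with ε hεl hεM hε
    exact (hΛ.flux_smul_div_mem_Icc (by fun_prop) hε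
      (fun θ hθ y hy => ⟨hεl θ hθ y hy, le_top⟩) hεM).1
  · filter_upwards [eventually_forall_lineMap_add (hlim.eventually_le_const hu) a b,
      eventually_forall_lineMap_add hbdd a b, self_mem_nhdsWithin] with ε hεu hεM hε
    exact (hΛ.flux_smul_div_mem_Icc (by fun_prop) hε
      (fun θ hθ y hy => ⟨zero_le, hεu θ hθ y hy⟩) hεM).2

end RegularAt

section LocalMoments

/-- The covariances of a Lévy–Chentsov field with distance `d`. -/
noncomputable def levyChentsovCov (d : Plane → Plane → ℝ) (a b : Plane) : ℝ :=
  (d 0 a + d 0 b - d a b) / 2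

lemma abs_jump_le (c a : Plane) (p : Marked) : |jump c a p| ≤ |p.2.2| := by
  rw [abs_jump]
  exact Set.indicator_le_self' (fun _ _ => abs_nonneg _) p

lemma abs_jump_mul_jump_le (c a d b : Plane) (p : Marked) :
    |jump c a p * jump d b p| ≤ jump c a p ^ 2 := by
  rw [abs_mul, jump_sq, abs_jump]
  by_cases h : p ∈ sep c a
  · simp only [h, Set.indicator_of_mem]
    rw [← sq_abs, sq]
    exact mul_le_mul_of_nonneg_left (abs_jump_le d b p) (abs_nonneg _)
  · simp [h]

lemma lindebergWeight_mul_jump (t : ℝ) (c a : Plane) (p : Marked) :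
    lindebergWeight (t * jump c a p) = t ^ 2 * (jump c a p ^ 2 * min 1 (|t| * |p.2.2|)) := by
  rw [lindebergWeight, abs_mul, abs_jump, mul_pow, jump_sq]
  by_cases h : p ∈ sep c a <;> simp [h, mul_assoc]

lemma integral_jump_sq_mul (ν : Measure Marked) {g : ℝ × ℝ → ℝ≥0} (hg : Measurable g)
    (a b : Plane) : ∫ p, jump a b p ^ 2 * g p.2 ∂ν =
      (flux ν (fun q => g q * ENNReal.ofReal (q.2 ^ 2)) a b).toReal := by
  rw [integral_eq_lintegral_of_nonneg_ae (ae_of_all _ fun p => by positivity)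
      (Measurable.aestronglyMeasurable (by fun_prop)), flux,
    ← lintegral_indicator (measurableSet_sep a b)]
  congr with p
  rw [jump_sq]
  by_cases h : p ∈ sep a b
  · simp only [h, Set.indicator_of_mem]
    rw [ENNReal.ofReal_mul (by positivity), ENNReal.ofReal_coe_nnreal, mul_comm]
  · simp [h]

namespace IsCrossRegular

variable {ν : Measure Marked} (hν : IsCrossRegular ν)
include hν

lemma flux_ne_top {g : ℝ × ℝ → ℝ≥0} {C : ℝ≥0} (hC : ∀ q, g q ≤ C) (a b : Plane) :
    flux ν (fun q => g q * ENNReal.ofReal (q.2 ^ 2)) a b ≠ ∞ := by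
  refine ne_of_lt ?_
  calc flux ν (fun q => g q * ENNReal.ofReal (q.2 ^ 2)) a b
      ≤ flux ν (fun q => C * ENNReal.ofReal (q.2 ^ 2)) a b :=
        lintegral_mono fun p => mul_le_mul_left (ENNReal.coe_le_coe.2 (hC _)) _
    _ = C * secondMoment ν (cross a b) := by
        rw [← lintegral_jump_sq_eq_secondMoment_cross hν.null, lintegral_jump_sq, secondMoment_sep]
        exact lintegral_const_mul _ (by fun_prop)
    _ < ∞ := ENNReal.mul_lt_top ENNReal.coe_lt_top (hν.finite a b)

lemma abs_integral_jump_mul_jump_le (c a d b : Plane) :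
    |∫ p, jump c a p * jump d b p ∂ν| ≤ crossDist ν c a := by
  rw [← hν.integral_jump_sq]
  exact norm_integral_le_of_norm_le (f := fun p => jump c a p * jump d b p)
    (hν.integrable_jump_sq c a) (ae_of_all _ fun p => abs_jump_mul_jump_le c a d b p)

lemma integrable_jump_sq_mul_min (c a : Plane) {δ : ℝ} (hδ : 0 ≤ δ) :
    Integrable (fun p => jump c a p ^ 2 * min 1 (δ * |p.2.2|)) ν := by
  refine (hν.integrable_jump_sq c a).mono' (Measurable.aestronglyMeasurable (by fun_prop))
    (ae_of_all _ fun p => ?_)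
  rw [Real.norm_of_nonneg (by positivity)]
  exact mul_le_of_le_one_right (sq_nonneg _) (min_le_left _ _)

lemma tendsto_integral_jump_sq_mul_min (c a : Plane) :
    Tendsto (fun δ : ℝ => ∫ p, jump c a p ^ 2 * min 1 (δ * |p.2.2|) ∂ν) (𝓝[>] 0) (𝓝 0) := by
  suffices h : Tendsto (fun δ : ℝ => ∫ p, jump c a p ^ 2 * min 1 (δ * |p.2.2|) ∂ν) (𝓝[>] 0)
      (𝓝 (∫ _, 0 ∂ν)) by rwa [integral_zero] at h
  refine tendsto_integral_filter_of_dominated_convergence (fun p => jump c a p ^ 2)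
    (Eventually.of_forall fun δ => Measurable.aestronglyMeasurable (by fun_prop)) ?_
    (hν.integrable_jump_sq c a) (ae_of_all _ fun p => ?_)
  · filter_upwards [self_mem_nhdsWithin] with δ (hδ : 0 < δ)
    refine ae_of_all _ fun p => ?_
    rw [Real.norm_of_nonneg (by positivity)]
    exact mul_le_of_le_one_right (sq_nonneg _) (min_le_left _ _)
  · have h : Continuous fun δ : ℝ => jump c a p ^ 2 * min 1 (δ * |p.2.2|) := by fun_prop
    exact (h.tendsto' 0 0 (by simp)).mono_left nhdsWithin_le_nhds

end IsCrossRegular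

lemma IsLocalDensity.crossDist_tildeMeasure {μ : Measure Marked} {Λ : ℝ → Kernel ℝ (ℝ × ℝ)}
    (hΛ : IsLocalDensity μ Λ) (z s : ℝ) (a b : Plane) :
    crossDist (tildeMeasure Λ z s) a b = crossDist μ (a + (z, s)) (b + (z, s)) := by
  rw [crossDist, hΛ.secondMoment_tildeMeasure, crossDist]

namespace RegularAt

variable {μ : Measure Marked} {Λ : ℝ → Kernel ℝ (ℝ × ℝ)} {z s : ℝ} (hreg : RegularAt Λ z s)
  (hΛ : IsLocalDensity μ Λ)
include hreg hΛ

lemma isCrossRegular_hatMeasure : IsCrossRegular (hatMeasure Λ z s) := by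
  have := hΛ.sFinite s
  exact isCrossRegular_prod hreg.finite

lemma tendsto_integral_jump_sq_mul {g : ℝ × ℝ → ℝ≥0} (hg : Continuous g) {C : ℝ≥0}
    (hC : ∀ q, g q ≤ C) (a b : Plane) :
    Tendsto (fun ε : ℝ => ε⁻¹ * ∫ p, jump (ε • a + (z, s)) (ε • b + (z, s)) p ^ 2 * g p.2 ∂μ)
      (𝓝[>] 0) (𝓝 (∫ p, jump a b p ^ 2 * g p.2 ∂(hatMeasure Λ z s))) := by
  rw [integral_jump_sq_mul _ hg.measurable]
  refine ((ENNReal.tendsto_toReal ((hreg.isCrossRegular_hatMeasure hΛ).flux_ne_top hC a b)).comp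
    (hreg.tendsto_flux hΛ hg hC a b)).congr' ?_
  filter_upwards [self_mem_nhdsWithin] with ε (hε : 0 < ε)
  rw [Function.comp_apply, ENNReal.toReal_div, ENNReal.toReal_ofReal hε.le,
    integral_jump_sq_mul _ hg.measurable, div_eq_inv_mul]

lemma tendsto_crossDist (hM : InM μ) (a b : Plane) :
    Tendsto (fun ε : ℝ => ε⁻¹ * crossDist μ (ε • a + (z, s)) (ε • b + (z, s))) (𝓝[>] 0)
      (𝓝 (crossDist (hatMeasure Λ z s) a b)) := by
  have h := hreg.tendsto_integral_jump_sq_mul hΛ (g := fun _ => 1) (C := 1) continuous_const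
    (fun _ => le_rfl) a b
  simpa [(hΛ.isCrossRegular hM).integral_jump_sq,
    (hreg.isCrossRegular_hatMeasure hΛ).integral_jump_sq] using h

lemma tendsto_integral_jump_mul_jump (hM : InM μ) (a b : Plane) :
    Tendsto (fun ε : ℝ => ε⁻¹ * ∫ p, jump (z, s) (ε • a + (z, s)) p *
      jump (z, s) (ε • b + (z, s)) p ∂μ) (𝓝[>] 0)
      (𝓝 (levyChentsovCov (crossDist (hatMeasure Λ z s)) a b)) := by
  have h := (((hreg.tendsto_crossDist hΛ hM 0 a).add (hreg.tendsto_crossDist hΛ hM 0 b)).sub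
    (hreg.tendsto_crossDist hΛ hM a b)).div_const 2
  refine h.congr fun ε => ?_
  rw [(hΛ.isCrossRegular hM).integral_jump_mul_jump]
  simp only [smul_zero, zero_add]
  ring

lemma tendsto_integral_jump_sq_mul_min (hM : InM μ) (a : Plane) {δ : ℝ → ℝ}
    (hδ : Tendsto δ (𝓝[>] 0) (𝓝[≥] 0)) :
    Tendsto (fun ε : ℝ => ε⁻¹ * ∫ p, jump (z, s) (ε • a + (z, s)) p ^ 2 *
      min 1 (δ ε * |p.2.2|) ∂μ) (𝓝[>] 0) (𝓝 0) := by
  have hμ := hΛ.isCrossRegular hM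
  have hhat := (hreg.isCrossRegular_hatMeasure hΛ).tendsto_integral_jump_sq_mul_min 0 a
  obtain ⟨hδ, hδ_nonneg⟩ := tendsto_nhdsWithin_iff.1 hδ
  rw [Metric.tendsto_nhds]
  intro τ hτ
  obtain ⟨η, hητ, (hη : 0 < η)⟩ :=
    ((hhat.eventually_lt_const hτ).and self_mem_nhdsWithin).exists
  let g : ℝ × ℝ → ℝ≥0 := fun q => min 1 (η.toNNReal * ‖q.2‖₊)
  have hg (q : ℝ × ℝ) : ((g q : ℝ≥0) : ℝ) = min 1 (η * |q.2|) := by simp [g, hη.le]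
  have hlim := hreg.tendsto_integral_jump_sq_mul hΛ (g := g) (by fun_prop) (C := 1)
    (fun q => min_le_left _ _) 0 a
  simp only [hg, smul_zero, zero_add] at hlim
  filter_upwards [hlim.eventually_lt_const hητ, hδ.eventually_lt_const hη, hδ_nonneg,
    self_mem_nhdsWithin] with ε hlt hδη (hδε : 0 ≤ δ ε) (hε : 0 < ε)
  rw [Real.dist_0_eq_abs, abs_of_nonneg (by positivity)]
  refine lt_of_le_of_lt ?_ hlt
  gcongr ε⁻¹ * ?_
  refine integral_mono (hμ.integrable_jump_sq_mul_min _ _ hδε)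
    (hμ.integrable_jump_sq_mul_min _ _ hη.le) fun p => ?_
  dsimp only
  gcongr

end RegularAt

end LocalMoments

section Fields

lemma support_jump_subset_cross (c a : Plane) : Function.support (jump c a) ⊆ cross c a := by
  intro p hp
  have hsep : p ∈ sep c a := by
    by_contra h
    exact hp (abs_eq_zero.1 (by rw [abs_jump, Set.indicator_of_notMem h]))
  rw [mem_sep_iff] at hsep
  rw [mem_cross_iff, mul_nonpos_iff]
  grind

lemma InM.measure_support_jump_lt_top {μ : Measure Marked} (hM : InM μ) (c a : Plane) :
    μ (Function.support (jump c a)) < ∞ :=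
  (measure_mono (support_jump_subset_cross c a)).trans_lt (le_self_add.trans_lt (hM c a))

lemma relHeight_eq_integral {m : Measure Marked} {z s : ℝ} {b : Plane}
    (hb : Integrable (jump 0 (b + (z, s))) m) (hz : Integrable (jump 0 (z, s)) m) :
    relHeight m z s b = ∫ p, jump (z, s) (b + (z, s)) p ∂m := by
  rw [relHeight, height, height, step_eq_jump, step_eq_jump, ← integral_sub hb hz]
  congr with p
  exact jump_sub_jump _ _ _ _

lemma relHeight_scaledEmpirical {e : ℝ} (he : 0 ≤ e) (X : Set Marked) (z s : ℝ) (b : Plane) :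
    relHeight (scaledEmpirical e X) z s b = e * relHeight (empirical X) z s b := by
  simp only [relHeight, height, scaledEmpirical, integral_smul_measure, ENNReal.toReal_ofReal he,
    smul_eq_mul]
  ring

/-- The intensity measure of the Poisson process `X^{ε²}`. -/
noncomputable def intensity (μ : Measure Marked) (ε : ℝ) : Measure Marked :=
  ENNReal.ofReal (ε ^ 2)⁻¹ • μ

/-- The microscopic and macroscopic fluctuation fields as one field, indexed by two copies of the
plane. -/
noncomputable def fluctuationField (μ : Measure Marked) (z s ε : ℝ) (X : Set Marked) :
    Plane ⊕ Plane → ℝ :=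
  Sum.elim (microField μ z s ε X) (macroField μ z s ε X)

/-- The function of a marked line whose compensated Poisson integral is the fluctuation field. -/
noncomputable def fieldKernel (z s ε : ℝ) : Plane ⊕ Plane → Marked → ℝ :=
  Sum.elim (fun a p => √ε * jump (z, s) (ε • a + (z, s)) p)
    (fun b p => ε * jump (z, s) (b + (z, s)) p)

lemma integral_intensity (μ : Measure Marked) (ε : ℝ) (f : Marked → ℝ) :
    ∫ p, f p ∂(intensity μ ε) = (ε ^ 2)⁻¹ * ∫ p, f p ∂μ := by
  rw [intensity, integral_smul_measure, ENNReal.toReal_ofReal (by positivity), smul_eq_mul]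

variable {μ : Measure Marked} {z s ε : ℝ}

lemma compensatedIntegral_const_mul (ν : Measure Marked) (X : Set Marked) (t : ℝ)
    (f : Marked → ℝ) :
    compensatedIntegral ν X (fun p => t * f p) = t * compensatedIntegral ν X f := by
  simp only [compensatedIntegral, integral_const_mul, mul_sub]

lemma measurable_fieldKernel (z s ε : ℝ) (k : Plane ⊕ Plane) :
    Measurable (fieldKernel z s ε k) := by
  rcases k with a | b <;> exact (measurable_jump _ _).const_mul _

lemma IsCrossRegular.memLp_fieldKernel (hμ : IsCrossRegular μ) (z s ε : ℝ) (k : Plane ⊕ Plane) :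
    MemLp (fieldKernel z s ε k) 2 (intensity μ ε) := by
  rcases k with a | b <;>
    exact ((hμ.memLp_jump _ _).const_mul _).smul_measure ENNReal.ofReal_ne_top

lemma InM.intensity_support_jump_lt_top (hM : InM μ) (ε : ℝ) (c a : Plane) :
    intensity μ ε (Function.support (jump c a)) < ∞ :=
  ENNReal.mul_lt_top ENNReal.ofReal_lt_top (hM.measure_support_jump_lt_top c a)

lemma InM.intensity_support_fieldKernel_lt_top (hM : InM μ) (z s ε : ℝ) (k : Plane ⊕ Plane) :
    intensity μ ε (Function.support (fieldKernel z s ε k)) < ∞ := by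
  rcases k with a | b <;>
    exact (measure_mono (Function.support_mul_subset_right _ _)).trans_lt
      (hM.intensity_support_jump_lt_top ε _ _)

namespace IsPoissonProcess

variable {Ω : Type*} [MeasurableSpace Ω] {P : Measure Ω}
  {X : Ω → Set Marked} (hX : IsPoissonProcess P X (intensity μ ε)) (hε : 0 < ε)
  (hμ : IsCrossRegular μ) (hM : InM μ)
include hX hε hμ hM

lemma ae_relHeight_sub_eq (z s : ℝ) (b : Plane) : ∀ᵐ ω ∂P,
    relHeight (scaledEmpirical (ε ^ 2) (X ω)) z s b - relHeight μ z s b =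
      ε ^ 2 * compensatedIntegral (intensity μ ε) (X ω) (jump (z, s) (b + (z, s))) := by
  have hμ_int (a : Plane) : Integrable (jump 0 a) μ :=
    integrable_of_memLp_two_of_measure_support_lt_top (hμ.memLp_jump 0 a)
      (hM.measure_support_jump_lt_top 0 a)
  have hX_int (a : Plane) : ∀ᵐ ω ∂P, Integrable (jump 0 a) (empirical (X ω)) :=
    hX.ae_integrable (measurable_jump 0 a) (hM.intensity_support_jump_lt_top ε 0 a)
  filter_upwards [hX_int (b + (z, s)), hX_int (z, s)] with ω hb hz
  rw [relHeight_scaledEmpirical (sq_nonneg ε), relHeight_eq_integral hb hz,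
    relHeight_eq_integral (hμ_int _) (hμ_int _), compensatedIntegral, integral_intensity]
  field_simp

lemma ae_fluctuationField_eq (z s : ℝ) (k : Plane ⊕ Plane) : ∀ᵐ ω ∂P,
    fluctuationField μ z s ε (X ω) k =
      compensatedIntegral (intensity μ ε) (X ω) (fieldKernel z s ε k) := by
  rcases k with a | b
  · filter_upwards [hX.ae_relHeight_sub_eq hε hμ hM z s (ε • a)] with ω hω
    have hscale : ε ^ (-(1 / 2) : ℝ) * ε⁻¹ * ε ^ 2 = √ε := by
      rw [Real.rpow_neg hε.le, ← Real.sqrt_eq_rpow]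
      field_simp
      exact (Real.sq_sqrt hε.le).symm
    simp only [fluctuationField, fieldKernel, Sum.elim_inl, microField, hω,
      compensatedIntegral_const_mul, ← mul_assoc, hscale]
  · filter_upwards [hX.ae_relHeight_sub_eq hε hμ hM z s b] with ω hω
    simp only [fluctuationField, fieldKernel, Sum.elim_inr, macroField, hω,
      compensatedIntegral_const_mul]
    field_simp

end IsPoissonProcess

end Fields

section FieldMoments

/-- The covariances of a pair of independent Lévy–Chentsov fields with distances `d₁` and `d₂`,
indexed by two copies of the plane. -/
noncomputable def independentCov (d₁ d₂ : Plane → Plane → ℝ) : Plane ⊕ Plane → Plane ⊕ Plane → ℝ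
  | .inl a, .inl b => levyChentsovCov d₁ a b
  | .inr a, .inr b => levyChentsovCov d₂ a b
  | _, _ => 0

lemma integral_intensity_mul_mul (μ : Measure Marked) (ε x y : ℝ) (f g : Marked → ℝ) :
    ∫ p, x * f p * (y * g p) ∂(intensity μ ε) =
      (ε ^ 2)⁻¹ * (x * y * ∫ p, f p * g p ∂μ) := by
  simp_rw [mul_mul_mul_comm x]
  rw [integral_intensity, integral_const_mul]

lemma integral_fieldKernel_inl_mul_inl (μ : Measure Marked) (z s : ℝ) {ε : ℝ} (hε : 0 < ε)
    (a b : Plane) :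
    ∫ p, fieldKernel z s ε (.inl a) p * fieldKernel z s ε (.inl b) p ∂(intensity μ ε) =
      ε⁻¹ * ∫ p, jump (z, s) (ε • a + (z, s)) p * jump (z, s) (ε • b + (z, s)) p ∂μ := by
  simp only [fieldKernel, Sum.elim_inl, integral_intensity_mul_mul, Real.mul_self_sqrt hε.le]
  field_simp

lemma integral_fieldKernel_inl_mul_inr (μ : Measure Marked) (z s : ℝ) {ε : ℝ} (hε : 0 < ε)
    (a b : Plane) :
    ∫ p, fieldKernel z s ε (.inl a) p * fieldKernel z s ε (.inr b) p ∂(intensity μ ε) =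
      √ε * (ε⁻¹ * ∫ p, jump (z, s) (ε • a + (z, s)) p * jump (z, s) (b + (z, s)) p ∂μ) := by
  simp only [fieldKernel, Sum.elim_inl, Sum.elim_inr, integral_intensity_mul_mul]
  field_simp

lemma integral_fieldKernel_inr_mul_inr (μ : Measure Marked) (z s : ℝ) {ε : ℝ} (hε : 0 < ε)
    (a b : Plane) :
    ∫ p, fieldKernel z s ε (.inr a) p * fieldKernel z s ε (.inr b) p ∂(intensity μ ε) =
      ∫ p, jump (z, s) (a + (z, s)) p * jump (z, s) (b + (z, s)) p ∂μ := by
  simp only [fieldKernel, Sum.elim_inr, integral_intensity_mul_mul]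
  field_simp

lemma integral_lindebergWeight_fieldKernel_inl (μ : Measure Marked) (z s : ℝ) {ε : ℝ} (hε : 0 < ε)
    (a : Plane) :
    ∫ p, lindebergWeight (fieldKernel z s ε (.inl a) p) ∂(intensity μ ε) =
      ε⁻¹ * ∫ p, jump (z, s) (ε • a + (z, s)) p ^ 2 * min 1 (√ε * |p.2.2|) ∂μ := by
  simp only [fieldKernel, Sum.elim_inl, lindebergWeight_mul_jump, Real.sq_sqrt hε.le,
    abs_of_nonneg (Real.sqrt_nonneg ε)]
  rw [integral_intensity, integral_const_mul]
  field_simp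

lemma integral_lindebergWeight_fieldKernel_inr (μ : Measure Marked) (z s : ℝ) {ε : ℝ} (hε : 0 < ε)
    (b : Plane) :
    ∫ p, lindebergWeight (fieldKernel z s ε (.inr b) p) ∂(intensity μ ε) =
      ∫ p, jump (z, s) (b + (z, s)) p ^ 2 * min 1 (ε * |p.2.2|) ∂μ := by
  simp only [fieldKernel, Sum.elim_inr, lindebergWeight_mul_jump, abs_of_pos hε]
  rw [integral_intensity, integral_const_mul]
  field_simp

namespace RegularAt

variable {μ : Measure Marked} {Λ : ℝ → Kernel ℝ (ℝ × ℝ)} {z s : ℝ} (hreg : RegularAt Λ z s)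
  (hΛ : IsLocalDensity μ Λ) (hM : InM μ)
include hreg hΛ hM

/-- The microscopic and macroscopic fields decouple because the former only sees the mass of order
`ε` that crosses segments of size `ε`. -/
lemma tendsto_sqrt_mul_integral_jump_mul_jump (a b : Plane) :
    Tendsto (fun ε : ℝ => √ε * (ε⁻¹ * ∫ p, jump (z, s) (ε • a + (z, s)) p *
      jump (z, s) (b + (z, s)) p ∂μ)) (𝓝[>] 0) (𝓝 0) := by
  have hsqrt := tendsto_sqrt_nhdsGT_zero.mono_right nhdsWithin_le_nhds
  have hbound := hsqrt.mul (hreg.tendsto_crossDist hΛ hM 0 a)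
  rw [zero_mul] at hbound
  simp only [smul_zero, zero_add] at hbound
  refine squeeze_zero_norm' ?_ hbound
  filter_upwards [self_mem_nhdsWithin] with ε (hε : 0 < ε)
  rw [norm_mul, norm_mul, Real.norm_of_nonneg (Real.sqrt_nonneg ε),
    Real.norm_of_nonneg (inv_nonneg.2 hε.le), Real.norm_eq_abs]
  gcongr
  exact (hΛ.isCrossRegular hM).abs_integral_jump_mul_jump_le _ _ _ _

lemma tendsto_integral_fieldKernel_mul (k m : Plane ⊕ Plane) :
    Tendsto (fun ε => ∫ p, fieldKernel z s ε k p * fieldKernel z s ε m p ∂(intensity μ ε))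
      (𝓝[>] 0)
      (𝓝 (independentCov (crossDist (hatMeasure Λ z s)) (crossDist (tildeMeasure Λ z s)) k m)) := by
  have hpos : ∀ᶠ ε : ℝ in 𝓝[>] 0, 0 < ε := eventually_mem_nhdsWithin
  rcases k with a | a <;> rcases m with b | b
  · refine (hreg.tendsto_integral_jump_mul_jump hΛ hM a b).congr' ?_
    filter_upwards [hpos] with ε hε using (integral_fieldKernel_inl_mul_inl μ z s hε a b).symm
  · refine (hreg.tendsto_sqrt_mul_integral_jump_mul_jump hΛ hM a b).congr' ?_
    filter_upwards [hpos] with ε hε using (integral_fieldKernel_inl_mul_inr μ z s hε a b).symm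
  · refine (hreg.tendsto_sqrt_mul_integral_jump_mul_jump hΛ hM b a).congr' ?_
    filter_upwards [hpos] with ε hε
    rw [← integral_fieldKernel_inl_mul_inr μ z s hε b a]
    simp only [mul_comm]
  · have hcov : ∫ p, jump (z, s) (a + (z, s)) p * jump (z, s) (b + (z, s)) p ∂μ =
        levyChentsovCov (crossDist (tildeMeasure Λ z s)) a b := by
      rw [(hΛ.isCrossRegular hM).integral_jump_mul_jump, levyChentsovCov]
      simp only [hΛ.crossDist_tildeMeasure, zero_add]
    refine (tendsto_const_nhds.congr' ?_ : Tendsto _ _ (𝓝 (levyChentsovCov _ a b)))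
    filter_upwards [hpos] with ε hε
    rw [integral_fieldKernel_inr_mul_inr μ z s hε a b, hcov]

lemma tendsto_integral_lindebergWeight_fieldKernel (k : Plane ⊕ Plane) :
    Tendsto (fun ε => ∫ p, lindebergWeight (fieldKernel z s ε k p) ∂(intensity μ ε))
      (𝓝[>] 0) (𝓝 0) := by
  rcases k with a | b
  · refine (hreg.tendsto_integral_jump_sq_mul_min hΛ hM a (tendsto_sqrt_nhdsGT_zero.mono_right
      (nhdsWithin_mono 0 Set.Ioi_subset_Ici_self))).congr' ?_
    filter_upwards [self_mem_nhdsWithin] with ε hε using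
      (integral_lindebergWeight_fieldKernel_inl μ z s hε a).symm
  · refine ((hΛ.isCrossRegular hM).tendsto_integral_jump_sq_mul_min (z, s)
      (b + (z, s))).congr' ?_
    filter_upwards [self_mem_nhdsWithin] with ε hε using
      (integral_lindebergWeight_fieldKernel_inr μ z s hε b).symm

end RegularAt

end FieldMoments

section Limit

/-- The elementary surfaces of two measures as vectors of the orthogonal sum of the two `L²`
spaces; their Gram matrix is the covariance of a pair of independent Lévy–Chentsov fields. -/
noncomputable def jumpVector {ν₁ ν₂ : Measure Marked} (h₁ : IsCrossRegular ν₁)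
    (h₂ : IsCrossRegular ν₂) : Plane ⊕ Plane → WithLp 2 (Lp ℝ 2 ν₁ × Lp ℝ 2 ν₂) :=
  Sum.elim (fun a => WithLp.toLp 2 ((h₁.memLp_jump 0 a).toLp, 0))
    (fun b => WithLp.toLp 2 (0, (h₂.memLp_jump 0 b).toLp))

lemma IsCrossRegular.inner_toLp_jump {ν : Measure Marked} (hν : IsCrossRegular ν) (a b : Plane) :
    inner ℝ (hν.memLp_jump 0 a).toLp (hν.memLp_jump 0 b).toLp =
      levyChentsovCov (crossDist ν) a b := by
  rw [levyChentsovCov, ← hν.integral_jump_mul_jump, L2.inner_def]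
  refine integral_congr_ae ?_
  filter_upwards [(hν.memLp_jump 0 a).coeFn_toLp, (hν.memLp_jump 0 b).coeFn_toLp] with p ha hb
  rw [ha, hb]
  exact mul_comm _ _

lemma inner_jumpVector {ν₁ ν₂ : Measure Marked} (h₁ : IsCrossRegular ν₁)
    (h₂ : IsCrossRegular ν₂) (k m : Plane ⊕ Plane) :
    inner ℝ (jumpVector h₁ h₂ k) (jumpVector h₁ h₂ m) =
      independentCov (crossDist ν₁) (crossDist ν₂) k m := by
  rw [WithLp.prod_inner_apply]
  rcases k with a | a <;> rcases m with b | b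
  · simpa [jumpVector, independentCov] using h₁.inner_toLp_jump a b
  · simp [jumpVector, independentCov]
  · simp [jumpVector, independentCov]
  · simpa [jumpVector, independentCov] using h₂.inner_toLp_jump a b

/-- `ξ` is a pair of independent Lévy–Chentsov fields with distances `d₁` and `d₂`, presented as
one centered Gaussian field indexed by two copies of the plane. -/
structure IsLevyChentsovPair {Ω : Type*} [MeasurableSpace Ω] (P : Measure Ω)
    (ξ : Plane ⊕ Plane → Ω → ℝ) (d₁ d₂ : Plane → Plane → ℝ) : Prop where
  gaussian : IsGaussianProcess ξ P
  centered : ∀ k, ∫ ω, ξ k ω ∂P = 0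
  covariance : ∀ k m, cov[ξ k, ξ m; P] = independentCov d₁ d₂ k m

lemma exists_isLevyChentsovPair {ν₁ ν₂ : Measure Marked} (h₁ : IsCrossRegular ν₁)
    (h₂ : IsCrossRegular ν₂) :
    ∃ (Ω : Type) (_ : MeasurableSpace Ω) (P : Measure Ω) (_ : IsProbabilityMeasure P)
      (ξ : Plane ⊕ Plane → Ω → ℝ), IsLevyChentsovPair P ξ (crossDist ν₁) (crossDist ν₂) := by
  obtain ⟨Ω, _, P, hP, ξ, hgauss, hmean, hcov⟩ :=
    exists_isGaussianProcess_covariance_eq_inner (jumpVector h₁ h₂)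
  exact ⟨Ω, _, P, hP, ξ, hgauss, hmean, fun k m => (hcov k m).trans (inner_jumpVector h₁ h₂ k m)⟩

namespace IsLevyChentsovPair

variable {Ω : Type*} [MeasurableSpace Ω] {P : Measure Ω} {ξ : Plane ⊕ Plane → Ω → ℝ}
  {d₁ d₂ : Plane → Plane → ℝ} (hξ : IsLevyChentsovPair P ξ d₁ d₂)
include hξ

lemma isLevyChentsov_inl : IsLevyChentsov P (fun a => ξ (.inl a)) d₁ :=
  ⟨hξ.gaussian.comp_right Sum.inl, fun _ => hξ.centered _, fun _ _ => hξ.covariance _ _⟩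

lemma isLevyChentsov_inr : IsLevyChentsov P (fun b => ξ (.inr b)) d₂ :=
  ⟨hξ.gaussian.comp_right Sum.inr, fun _ => hξ.centered _, fun _ _ => hξ.covariance _ _⟩

lemma indepFun : IndepFun (fun ω a => ξ (.inl a) ω) (fun ω b => ξ (.inr b) ω) P := by
  refine IsGaussianProcess.indepFun_of_covariance_eq_zero (X := fun a => ξ (.inl a))
    (Y := fun b => ξ (.inr b)) ?_ (fun _ => hξ.gaussian.aemeasurable _)
    (fun _ => hξ.gaussian.aemeasurable _) (fun _ _ => hξ.covariance _ _)
  have h : (Sum.elim (fun a => ξ (.inl a)) fun b => ξ (.inr b)) = ξ := Sum.elim_comp_inl_inr ξ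
  rw [h]
  exact hξ.gaussian

end IsLevyChentsovPair

end Limit

instance : Scale.toZero.IsCountablyGenerated := by
  unfold Scale.toZero; infer_instance

lemma Scale.tendsto_val : Tendsto (fun ε : Scale => (ε : ℝ)) Scale.toZero (𝓝[>] 0) :=
  tendsto_nhdsWithin_iff.2 ⟨tendsto_comap, Eventually.of_forall fun ε => ε.2⟩

theorem tendstoInDistribution_fluctuationField {μ : Measure Marked} (hM : InM μ)
    {Λ : ℝ → Kernel ℝ (ℝ × ℝ)} (hΛ : IsLocalDensity μ Λ) {z s : ℝ} (hreg : RegularAt Λ z s)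
    {Ω : Scale → Type*} [∀ ε, MeasurableSpace (Ω ε)] {P : ∀ ε, Measure (Ω ε)}
    [∀ ε, IsProbabilityMeasure (P ε)] {X : ∀ ε, Ω ε → Set Marked}
    (hX : ∀ ε : Scale, IsPoissonProcess (P ε) (X ε) (intensity μ ε))
    {Ω' : Type*} [MeasurableSpace Ω'] {P' : Measure Ω'} [IsProbabilityMeasure P']
    {ξ : Plane ⊕ Plane → Ω' → ℝ} (hξ : IsLevyChentsovPair P' ξ
      (crossDist (hatMeasure Λ z s)) (crossDist (tildeMeasure Λ z s)))
    {K : Type*} [Finite K] (κ : K → Plane ⊕ Plane) :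
    TendstoInDistribution (fun (ε : Scale) ω k => fluctuationField μ z s ε (X ε ω) (κ k))
      Scale.toZero (fun ω k => ξ (κ k) ω) P P' := by
  have hμ := hΛ.isCrossRegular hM
  refine (tendstoInDistribution_compensatedIntegral hX
    (f := fun (ε : Scale) k => fieldKernel z s ε (κ k))
    (fun ε k => measurable_fieldKernel z s ε (κ k))
    (fun ε k => hμ.memLp_fieldKernel z s ε (κ k))
    (fun ε k => hM.intensity_support_fieldKernel_lt_top z s ε (κ k))
    (hasGaussianLaw_comp hξ.gaussian κ) (fun k => hξ.centered (κ k)) (fun k m => ?_)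
    fun k => ?_).congr (fun ε => ?_) .rfl
  · rw [hξ.covariance]
    exact (hreg.tendsto_integral_fieldKernel_mul hΛ hM _ _).comp Scale.tendsto_val
  · exact (hreg.tendsto_integral_lindebergWeight_fieldKernel hΛ hM _).comp Scale.tendsto_val
  · filter_upwards [ae_all_iff.2 fun k => (hX ε).ae_fluctuationField_eq ε.2 hμ hM z s (κ k)]
      with ω hω using funext fun k => (hω k).symm

end Multitime

open Multitime in
theorem theorem3_general
    (μ : Measure Marked) (hM : InM μ)
    (Λ : ℝ → Kernel ℝ (ℝ × ℝ)) (hΛ : IsLocalDensity μ Λ)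
    (z s : ℝ) (hreg : RegularAt Λ z s)
    (Ω : Scale → Type*) [∀ ε, MeasurableSpace (Ω ε)]
    (P : ∀ ε, Measure (Ω ε)) [∀ ε, IsProbabilityMeasure (P ε)]
    (X : ∀ ε, Ω ε → Set Marked)
    (hX : ∀ ε : Scale, IsPoissonProcess (P ε) (X ε) (ENNReal.ofReal (ε : ℝ)⁻¹ • μ)) :
    ∃ (Ω' : Type) (_ : MeasurableSpace Ω') (P' : Measure Ω') (_ : IsProbabilityMeasure P')
      (ηhat ηtilde : Plane → Ω' → ℝ),
      IsLevyChentsov P' ηhat (crossDist (hatMeasure Λ z s)) ∧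
      IsLevyChentsov P' ηtilde (crossDist (tildeMeasure Λ z s)) ∧
      IndepFun (fun ω a => ηhat a ω) (fun ω a => ηtilde a ω) P' ∧
      ∀ I J : Finset Plane,
        TendstoInDistribution
          (fun (ε : Scale) (ω : Ω ε.sq) =>
            ((fun a : I => microField μ z s ε (X ε.sq ω) a,
              fun b : J => macroField μ z s ε (X ε.sq ω) b) : (I → ℝ) × (J → ℝ)))
          Scale.toZero
          (fun ω => (fun a : I => ηhat a ω, fun b : J => ηtilde b ω))
          (fun ε => P ε.sq) P' := by
  obtain ⟨Ω', _, P', _, ξ, hξ⟩ := exists_isLevyChentsovPair (hreg.isCrossRegular_hatMeasure hΛ)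
    (hΛ.isCrossRegular_tildeMeasure hM z s)
  refine ⟨Ω', _, P', inferInstance, fun a => ξ (.inl a), fun b => ξ (.inr b),
    hξ.isLevyChentsov_inl, hξ.isLevyChentsov_inr, hξ.indepFun, fun I J => ?_⟩
  let κ : I ⊕ J → Plane ⊕ Plane := Sum.map Subtype.val Subtype.val
  have hlim := tendstoInDistribution_fluctuationField hM hΛ hreg (fun ε => hX ε.sq) hξ κ
  exact hlim.continuous_comp (g := fun x : I ⊕ J → ℝ => (x ∘ Sum.inl, x ∘ Sum.inr)) (by fun_prop)

theorem theorem3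
    (ρ : ℝ → ℝ) (hρ_nonneg : ∀ x, 0 ≤ ρ x) (hρ : LocallyIntegrable ρ)
    (κ : Kernel ℝ (ℝ × ℝ)) [IsMarkovKernel κ]
    (μ : Measure Multitime.Marked) (hμ : μ = Multitime.ofDensity ρ κ)
    (hM : Multitime.InM μ)
    (Λ : ℝ → Kernel ℝ (ℝ × ℝ)) (hΛ : Multitime.IsLocalDensity μ Λ)
    (z s : ℝ) (hreg : Multitime.RegularAt Λ z s)
    (Ω : Multitime.Scale → Type*) [∀ ε, MeasurableSpace (Ω ε)]
    (P : ∀ ε, Measure (Ω ε)) [∀ ε, IsProbabilityMeasure (P ε)]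
    (X : ∀ ε, Ω ε → Set Multitime.Marked)
    (hX : ∀ ε : Multitime.Scale,
      Multitime.IsPoissonProcess (P ε) (X ε) (ENNReal.ofReal (ε : ℝ)⁻¹ • μ)) :
    ∃ (Ω' : Type) (_ : MeasurableSpace Ω') (P' : Measure Ω') (_ : IsProbabilityMeasure P')
      (ηhat ηtilde : Multitime.Plane → Ω' → ℝ),
      Multitime.IsLevyChentsov P' ηhat
        (Multitime.crossDist (Multitime.hatMeasure Λ z s)) ∧
      Multitime.IsLevyChentsov P' ηtilde
        (Multitime.crossDist (Multitime.tildeMeasure Λ z s)) ∧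
      IndepFun (fun ω a => ηhat a ω) (fun ω a => ηtilde a ω) P' ∧
      ∀ I J : Finset Multitime.Plane,
        TendstoInDistribution
          (fun (ε : Multitime.Scale) (ω : Ω ε.sq) =>
            ((fun a : I => Multitime.microField μ z s ε (X ε.sq ω) a,
              fun b : J => Multitime.macroField μ z s ε (X ε.sq ω) b) :
              (I → ℝ) × (J → ℝ)))
          Multitime.Scale.toZero
          (fun ω => (fun a : I => ηhat a ω, fun b : J => ηtilde b ω))
          (fun ε => P ε.sq) P' :=
  theorem3_general μ hM Λ hΛ z s hreg Ω P X hX
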